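/- **Corollary (numerical quantization for elliptic curves).** Let $\omega_+,\omega_-\in\mathbb C$ be linearly independent over $\mathbb R$, let $C=\mathbb C/(\mathbb Z\omega_++\mathbb Z\omega_-)$ be the corresponding elliptic curve with the decomposition $C=S^1_+\times S^1_-$ into circle groups given by this basis, and let $\pi\colon C\to S^1_-=\mathrm U(1)$, $\pi([x\omega_++y\omega_-])=e^{2\pi i y}$ for $x,y\in\mathbb R$, be the real polarization by the translates of $S^1_+$. Let $\omega$ be the translation-invariant Kähler form on $C$ with $\int_C\omega=1$, and let $(L,a)$ be a Hermitian line bundle on $C$ with a unitary connection of curvature $F_a=-2\pi i\,\omega$ (a polarization of degree $1$); $L$ carries the holomorphic structure defined by $\bar\partial_a$. For $k\ge 1$ equip $L^k=L^{\otimes k}$ with the induced connection $ka$ and put $\mathcal H_{L^k}=H^0(C,L^k)$. Every fibre $\pi^{-1}(b)$ is a circle, on which $ka$ is flat; it is called a Bohr–Sommerfeld fibre of level $k$ if the holonomy character $\chi_{k,b}\in\operatorname{Hom}(\pi_1(\pi^{-1}(b)),\mathrm U(1))$ of $ka$ on it is trivial. Let $\mathcal H^k_\pi$ be the direct sum, over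 the Bohr–Sommerfeld fibres of level $k$, of the spaces of covariant constant sections of $(L^k,ka)$ over the fibre. In $\operatorname{Pic}(C/S^1_-)=\{(b,\chi)\mid b\in S^1_-,\ \chi\in\operatorname{Hom}(\pi_1(\pi^{-1}(b)),\mathrm U(1))\}$ let $s_0=\{(b,1)\}$ and $s_{L^k}=\{(b,\chi_{k,b})\}$. Then there is exactly one Bohr–Sommerfeld fibre of level $1$, over a point $b_0$ say, and for every $k\ge 1$: 1. $\operatorname{rank}\mathcal H_{L^k}=k$, there are exactly $k$ Bohr–Sommerfeld fibres of level $k$, over each of them the space of covariant constant sections of $(L^k,ka)$ is one-dimensional, and $$\operatorname{rank}\mathcal H_{L^k}=\operatorname{rank}\mathcal H^k_\pi ;$$ 2. $s_{L^k}$ is a section of $\operatorname{Pic}(C/S^1_-)\to S^1_-$, the Bohr–Sommerfeld fibres of level $k$ are those over the points $b_0\zeta$ with $\zeta^k=1$, and $s_0\cap s_{L^k}=\{(b_0\zeta,1)\mid \zeta^k=1\}$. In other words, if $b_0$ is taken as the origin of the base circle, they are the $k$-th roots of unity. -/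

import Mathlib

open scoped ContDiff DirectSum

noncomputable section

/-- An elliptic curve `C = ℂ / (ℤ ω₊ + ℤ ω₋)` together with a decomposition
`C = S¹₊ × S¹₋` as a commutative Lie group, i.e. a `ℤ`-basis `(ω₊, ω₋)` of its period lattice. -/
structure MarkedEllipticCurve where
  /-- the period along the circle `S¹₊` -/
  ωp : ℂ
  /-- the period along the circle `S¹₋` -/
  ωm : ℂ
  linearIndependent : LinearIndependent ℝ ![ωp, ωm]

namespace MarkedEllipticCurve

variable (C : MarkedEllipticCurve)

/-- The period lattice. -/
def lattice : AddSubgroup ℂ := AddSubgroup.closure {C.ωp, C.ωm}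

/-- The points of the elliptic curve, with the quotient topology and group structure. -/
abbrev Points : Type := ℂ ⧸ C.lattice

/-- The universal covering `ℂ → C`. All differential calculus on `C` is done in the flat
coordinate `z ∈ ℂ`, through this local diffeomorphism; every tangent space of `C` is `ℂ`. -/
def cover (z : ℂ) : C.Points := QuotientAddGroup.mk z

theorem continuous_cover : Continuous C.cover := continuous_quotient_mk'

/-- The determinant `ω₊ ∧ ω₋` of the period basis. -/
def det : ℝ := (star C.ωp * C.ωm).im

theorem det_ne_zero : C.det ≠ 0 := by
  intro h
  have hl := C.linearIndependent
  rw [LinearIndependent.pair_iff] at hl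
  have hre : C.ωp.re * C.ωm.im - C.ωp.im * C.ωm.re = 0 := by
    have h' := h
    simp [det] at h'
    linarith
  have h1 := hl C.ωm.re (-C.ωp.re) (by
    apply Complex.ext <;> simp <;> linarith)
  have h2 := hl C.ωm.im (-C.ωp.im) (by
    apply Complex.ext <;> simp <;> linarith)
  have hp : C.ωp = 0 := Complex.ext (by simpa using h1.2) (by simpa using h2.2)
  have h3 := hl 1 0 (by simp [hp])
  exact one_ne_zero h3.1

/-- The real coordinate `y` of `z = x ω₊ + y ω₋`. -/
def coordMinus (z : ℂ) : ℝ := (star C.ωp * z).im / C.det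

/-- The homomorphism `x ω₊ + y ω₋ ↦ exp (2π i y)` on the universal cover. -/
def coverProj : ℂ →+ Additive Circle where
  toFun z := Additive.ofMul (Circle.exp (2 * Real.pi * C.coordMinus z))
  map_zero' := by simp [coordMinus]
  map_add' z w := by
    rw [← ofMul_mul, ← Circle.exp_add]
    congr 2
    simp only [coordMinus, mul_add, Complex.add_im]
    ring

theorem lattice_le_ker : C.lattice ≤ C.coverProj.ker := by
  rw [lattice, AddSubgroup.closure_le]
  rintro z (rfl | rfl)
  · have h : C.coordMinus C.ωp = 0 := by
      simp [coordMinus, mul_comm]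
    change Additive.ofMul _ = _
    rw [h]; simp
  · have h : C.coordMinus C.ωm = 1 := div_self C.det_ne_zero
    change Additive.ofMul _ = _
    rw [h]; simp

/-- The real polarization `π : C → S¹₋ = U(1)`, the second projection of `C = S¹₊ × S¹₋`.
Its fibres are the translates of the circle `S¹₊`, i.e. the images in `C` of the lines `z + ℝ ω₊`. -/
def realPolarization (x : C.Points) : Circle :=
  Additive.toMul (QuotientAddGroup.lift C.lattice C.coverProj C.lattice_le_ker x)

/-- The translation-invariant Kähler form of total area `1` on `C`, positive for the complex
orientation. -/
def kahlerForm (u v : ℂ) : ℝ := (star u * v).im / |C.det|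

/-- A smooth Hermitian line bundle on `C` with a Hermitian (unitary) connection, given in unitary
local frames `e i` over the members `U i` of an open cover. A section `s` is locally
`s = f i • e i`, the components satisfy `f i = g i j * f j` on overlaps, and the connection is
`∇ (f i • e i) = (d (f i) + √-1 * A i * f i) • e i`. Only the values of `g i j` on `U i ∩ U j` and
those of `A i` on `U i` matter. -/
structure HermitianLineBundle (ι : Type*) where
  U : ι → Set C.Points
  isOpen_U : ∀ i, IsOpen (U i)
  iUnion_U : ⋃ i, U i = Set.univ
  g : ι → ι → C.Points → Circle
  contDiffOn_g : ∀ i j,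
    ContDiffOn ℝ ∞ (fun z => (g i j (C.cover z) : ℂ)) (C.cover ⁻¹' (U i ∩ U j))
  cocycle : ∀ i j k x, x ∈ U i → x ∈ U j → x ∈ U k → g i j x * g j k x = g i k x
  A : ι → C.Points → (ℂ →L[ℝ] ℝ)
  contDiffOn_A : ∀ i, ContDiffOn ℝ ∞ (fun z => A i (C.cover z)) (C.cover ⁻¹' U i)
  gauge : ∀ i j z, C.cover z ∈ U i → C.cover z ∈ U j → ∀ v : ℂ,
    fderiv ℝ (fun w => (g i j (C.cover w) : ℂ)) z v =
      Complex.I * ((A j (C.cover z) v - A i (C.cover z) v : ℝ) : ℂ) * g i j (C.cover z)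

namespace HermitianLineBundle

variable {C} {ι : Type*} (L : C.HermitianLineBundle ι)

/-- The tensor power `(L, a)^{⊗ k} = (L^k, k a)`. -/
def pow (k : ℕ) : C.HermitianLineBundle ι where
  U := L.U
  isOpen_U := L.isOpen_U
  iUnion_U := L.iUnion_U
  g i j x := L.g i j x ^ k
  contDiffOn_g i j := by
    simpa using (L.contDiffOn_g i j).pow k
  cocycle i j l x hi hj hl := by
    rw [← mul_pow, L.cocycle i j l x hi hj hl]
  A i x := (k : ℝ) • L.A i x
  contDiffOn_A i := (L.contDiffOn_A i).const_smul (k : ℝ)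
  gauge i j z hi hj v := by
    have hopen : IsOpen (C.cover ⁻¹' (L.U i ∩ L.U j)) :=
      ((L.isOpen_U i).inter (L.isOpen_U j)).preimage C.continuous_cover
    have hd : DifferentiableAt ℝ (fun w => (L.g i j (C.cover w) : ℂ)) z :=
      ((L.contDiffOn_g i j).differentiableOn (by simp)).differentiableAt
        (hopen.mem_nhds ⟨hi, hj⟩)
    have hp := (hd.hasFDerivAt.pow k).fderiv
    simp only [Circle.coe_pow]
    rw [hp]
    rcases k with _ | k
    · simp
    · simp only [smul_apply, L.gauge i j z hi hj v, smul_eq_mul]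
      simp
      ring

/-- `(L, a)` is a polarization of degree one: its curvature `√-1 * d (A i)` is `-2π √-1 * ω`, where
`ω` is the translation-invariant Kähler form of total area `1`. Equivalently the Chern form
`(√-1 / 2π) F_a` is `ω`, so that `c₁(L) = [ω]` has degree `1`. -/
def IsDegreeOnePolarization : Prop :=
  ∀ i z, C.cover z ∈ L.U i → ∀ u v : ℂ,
    fderiv ℝ (fun w => L.A i (C.cover w)) z u v - fderiv ℝ (fun w => L.A i (C.cover w)) z v u =
      -(2 * Real.pi * C.kahlerForm u v)

/-- The component in the frame `e i` of the covariant derivative, in the direction `v`, of a section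
with component `f` in that frame. -/
def covDeriv (i : ι) (f : C.Points → ℂ) (z v : ℂ) : ℂ :=
  fderiv ℝ (fun w => f (C.cover w)) z v + Complex.I * (L.A i (C.cover z) v : ℂ) * f (C.cover z)

/-- The space `H⁰(C, L)` of holomorphic sections, for the holomorphic structure that the connection
defines: smooth sections with `∇_{∂/∂x} s + √-1 * ∇_{∂/∂y} s = 0`. The components `f i` are
extended by zero outside `U i`. -/
def holomorphicSections : Submodule ℂ (ι → C.Points → ℂ) where
  carrier := {f |
    (∀ i x, x ∉ L.U i → f i x = 0) ∧
    (∀ i j x, x ∈ L.U i → x ∈ L.U j → f i x = L.g i j x * f j x) ∧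
    (∀ i, ContDiffOn ℝ ∞ (fun z => f i (C.cover z)) (C.cover ⁻¹' L.U i)) ∧
    (∀ i z, C.cover z ∈ L.U i →
      L.covDeriv i (f i) z 1 + Complex.I * L.covDeriv i (f i) z Complex.I = 0)}
  zero_mem' := by
    refine ⟨by simp, by simp, fun i => contDiffOn_const, fun i z _ => by simp [covDeriv]⟩
  add_mem' := by
    rintro f f' ⟨h1, h2, h3, h4⟩ ⟨h1', h2', h3', h4'⟩
    refine ⟨fun i x hx => by simp [h1 i x hx, h1' i x hx], fun i j x hi hj => ?_,
      fun i => (h3 i).add (h3' i), fun i z hz => ?_⟩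
    · simp only [Pi.add_apply]
      rw [h2 i j x hi hj, h2' i j x hi hj]; ring
    · have ho := ((L.isOpen_U i).preimage C.continuous_cover).mem_nhds hz
      have d := ((h3 i).differentiableOn (by simp)).differentiableAt ho
      have d' := ((h3' i).differentiableOn (by simp)).differentiableAt ho
      have e := h4 i z hz
      have e' := h4' i z hz
      simp only [covDeriv, Pi.add_apply] at e e' ⊢
      rw [fderiv_fun_add d d']
      simp only [add_apply]
      linear_combination e + e'
  smul_mem' := by
    rintro c f ⟨h1, h2, h3, h4⟩
    refine ⟨fun i x hx => by simp [h1 i x hx], fun i j x hi hj => ?_,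
      fun i => (h3 i).const_smul c, fun i z hz => ?_⟩
    · simp only [Pi.smul_apply, smul_eq_mul]
      rw [h2 i j x hi hj]; ring
    · have ho := ((L.isOpen_U i).preimage C.continuous_cover).mem_nhds hz
      have d := ((h3 i).differentiableOn (by simp)).differentiableAt ho
      have e := h4 i z hz
      simp only [covDeriv, Pi.smul_apply] at e ⊢
      rw [fderiv_fun_const_smul d]
      simp only [smul_apply, smul_eq_mul]
      linear_combination c * e

/-- The space of covariant constant sections of the restriction of `(L, a)` to the fibre
`π⁻¹(b)`, whose tangent direction is `ω₊`. The components are extended by zero outside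
`U i ∩ π⁻¹(b)`. -/
def flatSections (b : Circle) : Submodule ℂ (ι → C.Points → ℂ) where
  carrier := {f |
    (∀ i x, ¬ (x ∈ L.U i ∧ C.realPolarization x = b) → f i x = 0) ∧
    (∀ i j x, x ∈ L.U i → x ∈ L.U j → f i x = L.g i j x * f j x) ∧
    (∀ i z, C.cover z ∈ L.U i → C.realPolarization (C.cover z) = b →
      HasDerivAt (fun t : ℝ => f i (C.cover (z + t * C.ωp)))
        (-(Complex.I * (L.A i (C.cover z) C.ωp : ℂ) * f i (C.cover z))) 0)}
  zero_mem' := by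
    refine ⟨by simp, by simp, fun i z _ _ => by simpa using hasDerivAt_const (0 : ℝ) (0 : ℂ)⟩
  add_mem' := by
    rintro f f' ⟨h1, h2, h3⟩ ⟨h1', h2', h3'⟩
    refine ⟨fun i x hx => by simp [h1 i x hx, h1' i x hx], fun i j x hi hj => ?_,
      fun i z hz hb => ?_⟩
    · simp only [Pi.add_apply]
      rw [h2 i j x hi hj, h2' i j x hi hj]; ring
    · refine ((h3 i z hz hb).add (h3' i z hz hb)).congr_deriv ?_
      simp only [Pi.add_apply]; ring
  smul_mem' := by
    rintro c f ⟨h1, h2, h3⟩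
    refine ⟨fun i x hx => by simp [h1 i x hx], fun i j x hi hj => ?_, fun i z hz hb => ?_⟩
    · simp only [Pi.smul_apply, smul_eq_mul]
      rw [h2 i j x hi hj]; ring
    · refine ((h3 i z hz hb).const_mul c).congr_deriv ?_
      simp only [Pi.smul_apply, smul_eq_mul]; ring

/-- `v` is a covariant constant section of the pullback of `(L, a)` to the universal cover
`ℝ → π⁻¹(b)`, `t ↦ [z + t ω₊]`, of the fibre through `[z]`; `v i t` is its component in the frame
`e i`, extended by zero where the curve is outside `U i`. -/
def IsParallelAlongFibre (z : ℂ) (v : ι → ℝ → ℂ) : Prop :=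
  (∀ (i : ι) (t : ℝ), C.cover (z + t * C.ωp) ∉ L.U i → v i t = 0) ∧
  (∀ (i j : ι) (t : ℝ), C.cover (z + t * C.ωp) ∈ L.U i → C.cover (z + t * C.ωp) ∈ L.U j →
    v i t = L.g i j (C.cover (z + t * C.ωp)) * v j t) ∧
  (∀ (i : ι) (t : ℝ), C.cover (z + t * C.ωp) ∈ L.U i →
    HasDerivAt (v i) (-(Complex.I * (L.A i (C.cover (z + t * C.ωp)) C.ωp : ℂ) * v i t)) t)

/-- `χ : π₁(π⁻¹(b)) → U(1)` is the character of the flat connection `a` restricted to `π⁻¹(b)`.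
The fundamental group of this circle is `ℤ`, acting on its universal cover `t ↦ [z + t ω₊]` by
integer translations, and parallel transport along the loop of class `n` is multiplication
by `χ n`. -/
def IsHolonomyCharacter (b : Circle) (χ : AddChar ℤ Circle) : Prop :=
  ∀ z, C.realPolarization (C.cover z) = b → ∀ v, L.IsParallelAlongFibre z v →
    ∀ (n : ℤ) (i : ι) (t : ℝ), v i (t + n) = χ n * v i t

/-- The fibre `π⁻¹(b)` is a Bohr–Sommerfeld fibre of `(L, a)`: its character is trivial. -/
def IsBohrSommerfeld (b : Circle) : Prop := L.IsHolonomyCharacter b 1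

/-- The space of wave functions of the real polarization `π`: the direct sum, over the
Bohr–Sommerfeld fibres of `(L, a)`, of the covariant constant sections over the fibre. -/
abbrev RealWaveFunctions : Type _ := ⨁ b : {b : Circle // L.IsBohrSommerfeld b}, L.flatSections b

/-- The cycle `s_L ⊆ Pic(C / S¹₋)` of the pairs `(b, a|π⁻¹(b))`. -/
def picSection : Set (Circle × AddChar ℤ Circle) := {p | L.IsHolonomyCharacter p.1 p.2}

end HermitianLineBundle

/-- The zero section `s₀` of the dual fibration `Pic(C / S¹₋) → S¹₋`, where
`Pic(C / S¹₋) = {(b, χ) | b ∈ S¹₋, χ ∈ Hom(π₁(π⁻¹(b)), U(1))}` and `π₁(π⁻¹(b)) = ℤ`. -/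
def picZeroSection : Set (Circle × AddChar ℤ Circle) := {p | p.2 = 1}

end MarkedEllipticCurve

end

/-! Everything is computed on the universal cover ℂ. There the pullback of L has a unitary frame `e`
whose connection form is the standard linear potential -π ω(z, ·): the two connections have the same
curvature, so they differ locally by exact forms, and the locally constant gluing data are trivial
because ℂ is simply connected (`exists_isFrame`). Under a period l the frame picks up a constant
phase times the exponential of a linear function of z (`exists_multiplier`). The powers of `e` serve
L^k, with potential k times as large.

Real side. Along a line z + ℝ ω₊ the parallel sections are explicit, and a full turn multiplies them
by c e^{2ikα}, where α = -π σ y is linear in the coordinate y of the base and σ is the sign of the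
orientation of the period basis. In terms of b = e^{2πiy} the holonomy of level k is therefore (c₁
b^{-σ})^k (`isHolonomyCharacter_pow_iff`). It is trivial exactly when b is c₁^σ times a k-th root of
unity. Over such a fibre the explicit parallel section descends, and it spans the flat sections.

Complex side. Dividing a section by the frame and multiplying by a Gaussian gauge turns the
∂̄-operator of the connection into the standard one. Holomorphic sections become exactly the entire
functions H with H(w + 1) = H(w) and H(w + τ) = c e^{-2πikw} H(w) (`range_toTheta`). The Fourier
coefficients of H satisfy a recursion of step k, so at most k of them are free; k theta functions
with characteristics, eigenvectors of translation by 1/k with distinct eigenvalues, show that all k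
occur (`finrank_thetaSpace`). -/

noncomputable section

/-! ### Theta functions of level k -/

/-- The entire functions `H` with `H (w + 1) = H w` and `H (w + τ) = c e^{-2π i k w} H w`. -/
def thetaSpace (k : ℕ) (τ c : ℂ) : Submodule ℂ (ℂ → ℂ) where
  carrier := {H | Differentiable ℂ H ∧ (∀ w, H (w + 1) = H w) ∧
    ∀ w, H (w + τ) = c * Complex.exp (-(2 * Real.pi * Complex.I * k * w)) * H w}
  zero_mem' := ⟨differentiable_const 0, by simp, by simp⟩
  add_mem' := by
    rintro f g ⟨h1, h2, h3⟩ ⟨h1', h2', h3'⟩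
    refine ⟨h1.add h1', fun w => by simp [h2, h2'], fun w => ?_⟩
    simp only [Pi.add_apply, h3, h3']; ring
  smul_mem' := by
    rintro a f ⟨h1, h2, h3⟩
    refine ⟨h1.const_smul a, fun w => by simp [h2], fun w => ?_⟩
    simp only [Pi.smul_apply, smul_eq_mul, h3]; ring

/-- The integral of a `1`-periodic entire function over a horizontal unit segment does not
depend on the segment. -/
theorem integral_unit_segment_eq {G : ℂ → ℂ} (hG : Differentiable ℂ G)
    (hper : ∀ w, G (w + 1) = G w) (τ : ℂ) :
    ∫ x in (0 : ℝ)..1, G (x + τ) = ∫ x in (0 : ℝ)..1, G x := by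
  obtain ⟨P, hP⟩ := (convex_univ (𝕜 := ℝ) (E := ℂ)).exists_forall_hasDerivWithinAt
    hG.differentiableOn
  have hP' : ∀ z, HasDerivAt P (G z) z := fun z => by simpa using hP z trivial
  have key : ∀ w : ℂ, ∫ x in (0 : ℝ)..1, G (x + w) = P (1 + w) - P w := by
    intro w
    have h := intervalIntegral.integral_eq_sub_of_hasDerivAt (a := 0) (b := 1)
      (f := fun x : ℝ => P (x + w)) (f' := fun x : ℝ => G (x + w))
      (fun x _ => ((hP' (x + w)).comp_add_const (x : ℂ) w).comp_ofReal)
      ((hG.continuous.comp (by fun_prop)).intervalIntegrable _ _)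
    simpa using h
  -- The unit increment of the primitive has derivative G(1 + w) - G(w) = 0.
  have hconst : ∀ w, P (1 + w) - P w = P (1 + 0) - P 0 := by
    intro w
    refine is_const_of_deriv_eq_zero (f := fun w => P (1 + w) - P w) ?_ ?_ w 0
    · exact fun z => (((hP' (1 + z)).comp_const_add 1 z).sub (hP' z)).differentiableAt
    · intro z
      have := (((hP' (1 + z)).comp_const_add 1 z).fun_sub (hP' z)).deriv
      rw [this, add_comm 1 z, hper, sub_self]
  rw [key, hconst, ← key]
  simp

/-- The `n`-th Fourier coefficient along the real axis. -/
def realFourierCoeff (n : ℤ) (H : ℂ → ℂ) : ℂ :=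
  ∫ x in (0 : ℝ)..1, H x * Complex.exp (-(2 * Real.pi * Complex.I * n * x))

/-- The contour ℝ is moved to ℝ + τ, which is allowed for a 1-periodic entire integrand;
quasi-periodicity then produces e^{-2πikx}, which raises the index by k. -/
theorem realFourierCoeff_eq_shift {k : ℕ} {τ c : ℂ} {H : ℂ → ℂ} (hH : H ∈ thetaSpace k τ c)
    (n : ℤ) :
    realFourierCoeff n H =
      c * Complex.exp (-(2 * Real.pi * Complex.I * n * τ)) * realFourierCoeff (n + k) H := by
  obtain ⟨h1, h2, h3⟩ := hH
  have h := integral_unit_segment_eq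
    (G := fun w => H w * Complex.exp (-(2 * Real.pi * Complex.I * n * w)))
    (h1.mul (by fun_prop)) (fun w => by
      simp only [h2]
      congr 1
      rw [← Complex.exp_periodic.int_mul n]
      congr 1
      ring) τ
  rw [realFourierCoeff, ← h, realFourierCoeff, ← intervalIntegral.integral_const_mul]
  congr 1
  ext x
  simp only [h3]
  have : Complex.exp (-(2 * Real.pi * Complex.I * (n + k : ℤ) * x)) =
      Complex.exp (-(2 * Real.pi * Complex.I * k * x)) *
        Complex.exp (-(2 * Real.pi * Complex.I * n * x)) := by
    rw [← Complex.exp_add]; push_cast; ring_nf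
  rw [this, mul_add, neg_add, Complex.exp_add]
  ring

/-- The recursion propagates zeros downwards directly, and upwards after cancelling c and the
exponential. -/
theorem realFourierCoeff_add_mul_eq_zero {k : ℕ} {τ c : ℂ} (hc : c ≠ 0) {H : ℂ → ℂ}
    (hH : H ∈ thetaSpace k τ c) {n : ℤ} (hn : realFourierCoeff n H = 0) (m : ℤ) :
    realFourierCoeff (n + k * m) H = 0 := by
  induction m using Int.induction_on with
  | zero => simpa using hn
  | succ m ih =>
    rw [realFourierCoeff_eq_shift hH] at ih
    simpa [hc, mul_add, add_assoc] using ih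
  | pred m ih =>
    rw [realFourierCoeff_eq_shift hH]
    have : n + k * (-(m : ℤ) - 1) + k = n + k * (-(m : ℤ)) := by ring
    rw [this, ih, mul_zero]

/-- Zero coefficients are summable, so the Fourier series converges uniformly to f, and its sum is
0. -/
theorem ContinuousMap.eq_zero_of_fourierCoeff_eq_zero {T : ℝ} [Fact (0 < T)]
    (f : C(AddCircle T, ℂ)) (hf : ∀ n, fourierCoeff f n = 0) : f = 0 := by
  have h0 : fourierCoeff f = fun _ => 0 := funext hf
  have hsum := hasSum_fourier_series_of_summable (f := f) (h0 ▸ summable_zero)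
  refine hsum.unique ?_
  convert! hasSum_zero (α := C(AddCircle T, ℂ)) (β := ℤ) using 2 with n
  rw [hf, zero_smul]

/-- A `1`-periodic entire function whose Fourier coefficients vanish is zero. -/
theorem eq_zero_of_realFourierCoeff_eq_zero {H : ℂ → ℂ} (hd : Differentiable ℂ H)
    (hper : ∀ w, H (w + 1) = H w) (h0 : ∀ n, realFourierCoeff n H = 0) : H = 0 := by
  have hp : Function.Periodic (fun x : ℝ => H x) 1 := fun x => by simpa using hper x
  have hcont : Continuous (hp.lift : AddCircle (1 : ℝ) → ℂ) :=
    continuous_coinduced_dom.mpr (hd.continuous.comp Complex.continuous_ofReal)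
  let f : C(AddCircle (1 : ℝ), ℂ) := ⟨hp.lift, hcont⟩
  have hfx : ∀ x : ℝ, f (x : AddCircle (1 : ℝ)) = H x := fun x => hp.lift_coe x
  have hf0 : f = 0 := by
    refine f.eq_zero_of_fourierCoeff_eq_zero fun n => ?_
    rw [fourierCoeff_eq_intervalIntegral _ _ 0, ← h0 n, realFourierCoeff]
    simp only [div_one, one_smul, zero_add]
    congr 1
    ext x
    rw [hfx, fourier_coe_apply, smul_eq_mul, mul_comm]
    congr 2
    push_cast
    ring
  have hreal : ∀ x : ℝ, H x = 0 := fun x => by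
    rw [← hfx, hf0, ContinuousMap.zero_apply]
  -- Identity theorem: H vanishes at the points 1/(n + 1), which accumulate at 0.
  have han : AnalyticOnNhd ℂ H Set.univ := fun z _ => hd.analyticAt z
  have := han.eqOn_zero_of_preconnected_of_frequently_eq_zero isPreconnected_univ
    (Set.mem_univ 0) (by
      have ht : Filter.Tendsto (fun n : ℕ => ((1 / ((n : ℝ) + 1) : ℝ) : ℂ)) Filter.atTop
          (nhdsWithin 0 {0}ᶜ) := by
        refine tendsto_nhdsWithin_iff.mpr ⟨?_, .of_forall fun n => ?_⟩
        · have := (Complex.continuous_ofReal.tendsto 0).comp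
            (tendsto_one_div_add_atTop_nhds_zero_nat (𝕜 := ℝ))
          simpa [Function.comp_def] using this
        · have : (n : ℂ) + 1 ≠ 0 := by exact_mod_cast n.succ_ne_zero
          simpa using this
      exact ht.frequently (.of_forall fun n => hreal _))
  funext z
  exact this (Set.mem_univ z)

theorem intervalIntegrable_realFourierCoeff {H : ℂ → ℂ} (hd : Differentiable ℂ H) (n : ℤ) :
    IntervalIntegrable (fun x : ℝ => H x * Complex.exp (-(2 * Real.pi * Complex.I * n * x)))
      MeasureTheory.volume 0 1 := by
  refine Continuous.intervalIntegrable ?_ _ _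
  have := hd.continuous
  fun_prop

/-- The Fourier coefficients of index `0, …, k - 1`. -/
def thetaCoeffs (k : ℕ) (τ c : ℂ) : thetaSpace k τ c →ₗ[ℂ] (Fin k → ℂ) where
  toFun H j := realFourierCoeff (j : ℕ) H.1
  map_add' H H' := by
    ext j
    simp only [realFourierCoeff, Submodule.coe_add, Pi.add_apply, add_mul]
    exact intervalIntegral.integral_add (intervalIntegrable_realFourierCoeff H.2.1 _)
      (intervalIntegrable_realFourierCoeff H'.2.1 _)
  map_smul' a H := by
    ext j
    simp only [realFourierCoeff, Submodule.coe_smul, Pi.smul_apply, smul_eq_mul, mul_assoc,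
      RingHom.id_apply]
    exact intervalIntegral.integral_const_mul _ _

/-- Every index is congruent mod k to one of 0, …, k - 1, so the recursion of step k forces all
Fourier coefficients to vanish. -/
theorem thetaCoeffs_injective {k : ℕ} (hk : 1 ≤ k) (τ : ℂ) {c : ℂ} (hc : c ≠ 0) :
    Function.Injective (thetaCoeffs k τ c) := by
  rw [injective_iff_map_eq_zero]
  rintro ⟨H, hH⟩ h
  refine Subtype.ext (eq_zero_of_realFourierCoeff_eq_zero hH.1 hH.2.1 fun n => ?_)
  have hk' : (0 : ℤ) < k := by exact_mod_cast hk
  have hlt := Int.emod_lt_of_pos n hk'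
  have hnn := Int.emod_nonneg n hk'.ne'
  rw [← Int.emod_add_mul_ediv n k]
  refine realFourierCoeff_add_mul_eq_zero hc hH ?_ _
  have := congrFun h ⟨(n % k).toNat, by omega⟩
  simpa [thetaCoeffs, Int.toNat_of_nonneg hnn] using this

/-- The average of `θ(·, τ)` over the real circle is `1`. -/
theorem integral_jacobiTheta₂ {τ : ℂ} (hτ : 0 < τ.im) :
    ∫ x in (0 : ℝ)..1, jacobiTheta₂ x τ = 1 := by
  let f : ℤ → C(ℝ, ℂ) := fun n => ⟨fun x => jacobiTheta₂_term n x τ, by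
    unfold jacobiTheta₂_term; fun_prop⟩
  -- On the real axis the norm of a term does not depend on x, so the terms at 0 dominate and the
  -- series may be integrated termwise. Only n = 0 survives.
  have hnorm : ∀ (n : ℤ) (x : ℝ), ‖f n x‖ = ‖jacobiTheta₂_term n 0 τ‖ := fun n x => by
    change ‖jacobiTheta₂_term n x τ‖ = _
    rw [norm_jacobiTheta₂_term, norm_jacobiTheta₂_term]; simp
  have hs : Summable fun n => ‖jacobiTheta₂_term n 0 τ‖ :=
    ((summable_jacobiTheta₂_term_iff 0 τ).mpr hτ).norm
  have h := intervalIntegral.hasSum_intervalIntegral_of_summable_norm (a := 0) (b := 1) (f := f)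
    (hs.of_nonneg_of_le (fun _ => norm_nonneg _) fun n =>
      (ContinuousMap.norm_le _ (norm_nonneg _)).mpr fun x => (hnorm n x).le)
  have hterm : ∀ n : ℤ, n ≠ 0 → ∫ x in (0 : ℝ)..1, f n x = 0 := by
    intro n hn
    have : ∀ x : ℝ, f n x = Complex.exp (2 * Real.pi * Complex.I * n * x) *
        Complex.exp (Real.pi * Complex.I * n ^ 2 * τ) := fun x => by
      rw [← Complex.exp_add]; rfl
    simp_rw [this]
    rw [intervalIntegral.integral_mul_const, integral_exp_mul_complex]
    · have h1 : Complex.exp (2 * Real.pi * Complex.I * n * (1 : ℝ)) = 1 :=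
        Complex.exp_eq_one_iff.mpr ⟨n, by push_cast; ring⟩
      rw [h1]; simp
    · simp [hn, Real.pi_ne_zero]
  have h0 := hasSum_single (f := fun n => ∫ x in (0 : ℝ)..1, f n x) 0 hterm
  have h2 : ∀ x : ℝ, ∑' n, f n x = jacobiTheta₂ x τ := fun x => rfl
  simp_rw [h2] at h
  rw [h.unique h0]
  simp [f, jacobiTheta₂_term]

theorem exists_jacobiTheta₂_ne_zero {τ : ℂ} (hτ : 0 < τ.im) : ∃ z, jacobiTheta₂ z τ ≠ 0 := by
  by_contra! h
  have := integral_jacobiTheta₂ hτ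
  simp [h] at this

/-- The theta function with characteristic `j`. -/
def thetaChar (k : ℕ) (τ s : ℂ) (j : ℕ) (w : ℂ) : ℂ :=
  Complex.exp (2 * Real.pi * Complex.I * j * w) * jacobiTheta₂ (k * w + j * τ + s) (k * τ)

theorem jacobiTheta₂_add_nat (z τ : ℂ) (n : ℕ) :
    jacobiTheta₂ (z + n) τ = jacobiTheta₂ z τ := by
  induction n with
  | zero => simp
  | succ n ih => rw [Nat.cast_succ, ← add_assoc, jacobiTheta₂_add_left, ih]

theorem im_natCast_mul_pos {k : ℕ} (hk : 1 ≤ k) {τ : ℂ} (hτ : 0 < τ.im) :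
    0 < ((k : ℂ) * τ).im := by
  have : (0 : ℝ) < k := by exact_mod_cast hk
  simpa using mul_pos this hτ

/-- Moving w by τ moves the argument of the theta function by its own quasi-period kτ. The shift jτ
in that argument contributes e^{-2πijτ}, which cancels the factor from the prefactor, so the
multiplier is the same for all j. -/
theorem thetaChar_mem {k : ℕ} (hk : 1 ≤ k) {τ : ℂ} (hτ : 0 < τ.im) (s : ℂ) (j : ℕ) :
    thetaChar k τ s j ∈
      thetaSpace k τ (Complex.exp (-(Real.pi * Complex.I * (k * τ + 2 * s)))) := by
  refine ⟨fun w => ?_, fun w => ?_, fun w => ?_⟩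
  · refine DifferentiableAt.mul (by fun_prop) ?_
    exact (differentiableAt_jacobiTheta₂_fst _ (im_natCast_mul_pos hk hτ)).comp
      (f := fun w : ℂ => k * w + j * τ + s) w (by fun_prop)
  · simp only [thetaChar]
    congr 1
    · rw [← Complex.exp_periodic.nat_mul j (2 * Real.pi * Complex.I * j * w)]
      congr 1
      ring
    · rw [← jacobiTheta₂_add_nat (k * w + j * τ + s) _ k]
      congr 1
      ring
  · simp only [thetaChar]
    have : (k : ℂ) * (w + τ) + j * τ + s = (k * w + j * τ + s) + k * τ := by ring
    rw [this, jacobiTheta₂_add_left', ← mul_assoc, ← mul_assoc, ← Complex.exp_add,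
      ← Complex.exp_add, ← Complex.exp_add]
    congr 2
    ring

/-- Translation of functions by `a`, as a linear map. -/
def translateLinear (a : ℂ) : Module.End ℂ (ℂ → ℂ) := LinearMap.funLeft ℂ ℂ (· + a)

/-- Moving w by 1/k moves the argument of the theta function by its period 1, so only the
exponential prefactor changes. -/
theorem thetaChar_hasEigenvector {k : ℕ} (hk : 1 ≤ k) {τ : ℂ} (hτ : 0 < τ.im) (s : ℂ)
    (j : ℕ) :
    (translateLinear (1 / k)).HasEigenvector (Complex.exp (2 * Real.pi * Complex.I / k) ^ j)
      (thetaChar k τ s j) := by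
  have hk0 : (k : ℂ) ≠ 0 := by exact_mod_cast (by omega : k ≠ 0)
  refine Module.End.hasEigenvector_iff.mpr ⟨Module.End.mem_eigenspace_iff.mpr ?_, ?_⟩
  · funext w
    change thetaChar k τ s j (w + 1 / k) = _ * _
    simp only [thetaChar]
    have : (k : ℂ) * (w + 1 / k) + j * τ + s = (k * w + j * τ + s) + 1 := by
      field_simp; ring
    rw [this, jacobiTheta₂_add_left, ← mul_assoc, ← Complex.exp_nat_mul, ← Complex.exp_add]
    congr 2
    field_simp
    ring
  · intro h0
    obtain ⟨z, hz⟩ := exists_jacobiTheta₂_ne_zero (im_natCast_mul_pos hk hτ)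
    have := congrFun h0 ((z - j * τ - s) / k)
    simp only [thetaChar, mul_div_cancel₀ _ hk0, Pi.zero_apply, mul_eq_zero,
      Complex.exp_ne_zero, false_or] at this
    apply hz
    rw [← this]
    congr 1
    ring

theorem linearIndependent_thetaChar {k : ℕ} (hk : 1 ≤ k) {τ : ℂ} (hτ : 0 < τ.im) (s : ℂ) :
    LinearIndependent ℂ fun j : Fin k => thetaChar k τ s j :=
  Module.End.eigenvectors_linearIndependent' (translateLinear (1 / k))
    (fun j : Fin k => Complex.exp (2 * Real.pi * Complex.I / k) ^ (j : ℕ))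
    (fun i j h => Fin.ext ((Complex.isPrimitiveRoot_exp k (by omega)).pow_inj i.2 j.2 h)) _
    fun j => thetaChar_hasEigenvector hk hτ s j

theorem finrank_thetaSpace {k : ℕ} (hk : 1 ≤ k) {τ c : ℂ} (hτ : 0 < τ.im) (hc : c ≠ 0) :
    Module.finrank ℂ (thetaSpace k τ c) = k := by
  have hinj := thetaCoeffs_injective hk τ hc
  have : Module.Finite ℂ (thetaSpace k τ c) := Module.Finite.of_injective _ hinj
  refine le_antisymm ?_ ?_
  · simpa using LinearMap.finrank_le_finrank_of_injective hinj
  · have hpi : (Real.pi : ℂ) * Complex.I ≠ 0 := by simp [Real.pi_ne_zero]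
    -- The shift s is free; solving -πi(kτ + 2s) = log c makes the multiplier of the characteristics
    -- equal to c.
    obtain ⟨s, hs⟩ : ∃ s : ℂ, Complex.exp (-(Real.pi * Complex.I * (k * τ + 2 * s))) = c := by
      refine ⟨-(Complex.log c / (Real.pi * Complex.I) + k * τ) / 2, ?_⟩
      rw [← Complex.exp_log hc]
      congr 1
      rw [Complex.log_exp (Complex.neg_pi_lt_log_im c) (Complex.log_im_le_pi c)]
      field_simp
      ring
    have hli : LinearIndependent ℂ (fun j : Fin k =>
        (⟨thetaChar k τ s j, hs ▸ thetaChar_mem hk hτ s j⟩ : thetaSpace k τ c)) :=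
      LinearIndependent.of_comp (thetaSpace k τ c).subtype
        (linearIndependent_thetaChar hk hτ s)
    simpa using hli.fintype_card_le_finrank

end

/-! ### A unitary frame with standard connection form on the universal cover -/

noncomputable section

/-- A locally constant cocycle on a simply connected space is a coboundary. -/
theorem exists_locallyConstant_coboundary {X G κ : Type*} [TopologicalSpace X]
    [SimplyConnectedSpace X] [LocallyPathConnectedSpace X] [Group G]
    (W : κ → Set X) (hW : ∀ a, IsOpen (W a)) (idx : X → κ) (hidx : ∀ x, x ∈ W (idx x))
    (c : κ → κ → X → G)
    (hc : ∀ a b d x, x ∈ W a → x ∈ W b → x ∈ W d → c a b x * c b d x = c a d x)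
    (hloc : ∀ a b x, x ∈ W a → x ∈ W b → ∀ᶠ y in nhds x, c a b y = c a b x) :
    ∃ h : κ → X → G, (∀ a b x, x ∈ W a → x ∈ W b → h a x = c a b x * h b x) ∧
      ∀ a x, x ∈ W a → ∀ᶠ y in nhds x, h a y = h a x := by
  -- With G discrete, the locally constant cocycle glues a covering space of X with fibre G.
  let _ : TopologicalSpace G := ⊥
  have : DiscreteTopology G := ⟨rfl⟩
  have hself : ∀ a x, x ∈ W a → c a a x = 1 := fun a x hx => by
    simpa using hc a a a x hx hx hx
  let Z : FiberBundleCore κ X G :=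
    { baseSet := W
      isOpen_baseSet := hW
      indexAt := idx
      mem_baseSet_at := hidx
      coordChange := fun a b x v => c b a x * v
      coordChange_self := fun a x hx v => by rw [hself a x hx, one_mul]
      continuousOn_coordChange := by
        rintro a b ⟨x, v⟩ ⟨⟨ha, hb⟩, -⟩
        refine ContinuousAt.continuousWithinAt ?_
        have h1 : ∀ᶠ p : X × G in nhds (x, v), c b a p.1 = c b a x :=
          (continuous_fst.tendsto (x, v)).eventually (hloc b a x hb ha)
        have h2 : ∀ᶠ p : X × G in nhds (x, v), p.2 = v :=
          (continuous_snd.tendsto (x, v)).eventually (p := fun u => u = v) (by simp [nhds_discrete])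
        refine continuousAt_const (y := c b a x * v) |>.congr ?_
        filter_upwards [h1, h2] with p hp1 hp2
        rw [hp1, hp2]
      coordChange_comp := fun a b d x hx v => by
        rw [← mul_assoc, hc d b a x hx.2 hx.1.2 hx.1.1] }
  have hcov : IsCoveringMap (Bundle.TotalSpace.proj : Z.TotalSpace → X) :=
    FiberBundle.isCoveringMap (F := G) (E := Z.Fiber)
  obtain ⟨x₀⟩ : Nonempty X := inferInstance
  -- As X is simply connected, its identity map lifts to a global section of the covering. The
  -- coordinates of this section in the charts are the functions h.
  obtain ⟨σ, ⟨-, hσ⟩, -⟩ := hcov.existsUnique_continuousMap_lifts (ContinuousMap.id X) x₀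
    (⟨x₀, (1 : G)⟩ : Z.TotalSpace) rfl
  have hσ' : ∀ x, (σ x).1 = x := fun x => congrFun hσ x
  refine ⟨fun a x => (Z.localTriv a (σ x)).2, fun a b x ha hb => ?_, fun a x hx => ?_⟩
  · let v : G := (σ x).2
    change c a (idx (σ x).1) (σ x).1 * v = c a b x * (c b (idx (σ x).1) (σ x).1 * v)
    rw [← mul_assoc, hσ' x, hc a b (idx x) x ha hb (hidx x)]
  · have hmem : σ x ∈ (Z.localTriv a).source := by
      change (σ x).1 ∈ W a
      rwa [hσ']
    have hcont : ContinuousAt (fun y => (Z.localTriv a (σ y)).2) x :=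
      (continuous_snd.continuousAt).comp
        (((Z.localTriv a).continuousAt hmem).comp σ.continuous.continuousAt)
    exact hcont.tendsto.eventually_mem (s := {(Z.localTriv a (σ x)).2})
      (mem_nhds_discrete.mpr rfl)

namespace MarkedEllipticCurve

variable (C : MarkedEllipticCurve)

/-- The potential `v ↦ -π ω(z, v)` of the curvature form `-2π ω`, as a bilinear form. -/
def potential : ℂ →L[ℝ] ℂ →L[ℝ] ℝ :=
  LinearMap.toContinuousLinearMap
    { toFun := fun z => LinearMap.toContinuousLinearMap
        { toFun := fun v => -(Real.pi * C.kahlerForm z v)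
          map_add' := fun v w => by simp only [kahlerForm, mul_add, Complex.add_im]; ring
          map_smul' := fun r v => by
            simp only [kahlerForm, Complex.real_smul, RingHom.id_apply, smul_eq_mul,
              mul_left_comm (star z) (r : ℂ), Complex.im_ofReal_mul]; ring }
      map_add' := fun z w => by
        ext v
        simp [kahlerForm]; ring
      map_smul' := fun r z => by
        ext v
        simp [kahlerForm]; ring }

theorem potential_apply (z v : ℂ) : C.potential z v = -(Real.pi * C.kahlerForm z v) := rfl

theorem potential_swap (z v : ℂ) : C.potential v z = -C.potential z v := by
  simp only [potential_apply, kahlerForm, Complex.mul_im, Complex.star_def, Complex.conj_re,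
    Complex.conj_im]
  ring

theorem potential_self (z : ℂ) : C.potential z z = 0 := by
  have := C.potential_swap z z; linarith

theorem cover_add {l : ℂ} (hl : l ∈ C.lattice) (z : ℂ) : C.cover (z + l) = C.cover z := by
  rw [cover, cover, QuotientAddGroup.eq]
  simpa using hl

namespace HermitianLineBundle

variable {C} {ι : Type*} (L : C.HermitianLineBundle ι)

theorem exists_mem_U (x : C.Points) : ∃ i, x ∈ L.U i := by
  have : x ∈ ⋃ i, L.U i := L.iUnion_U ▸ Set.mem_univ x
  simpa using this

theorem isOpen_preimage_U (i : ι) : IsOpen (C.cover ⁻¹' L.U i) :=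
  (L.isOpen_U i).preimage C.continuous_cover

theorem hasFDerivAt_g {i j : ι} {z : ℂ} (hi : C.cover z ∈ L.U i) (hj : C.cover z ∈ L.U j) :
    HasFDerivAt (fun w => (L.g i j (C.cover w) : ℂ))
      ((Complex.I * L.g i j (C.cover z)) • Complex.ofRealCLM.comp
        (L.A j (C.cover z) - L.A i (C.cover z))) z := by
  have hd : DifferentiableAt ℝ (fun w => (L.g i j (C.cover w) : ℂ)) z :=
    ((L.contDiffOn_g i j).differentiableOn (by simp)).differentiableAt
      (((L.isOpen_preimage_U i).inter (L.isOpen_preimage_U j)).mem_nhds ⟨hi, hj⟩)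
  convert! hd.hasFDerivAt using 1
  ext v
  rw [L.gauge i j z hi hj]
  simp [mul_right_comm]

/-- A unitary frame `e` of the pullback of the bundle to the universal cover, in which the
connection form is `k` times the standard potential; `e i` is its component in the `i`-th local
frame, extended by zero. -/
structure IsFrame (k : ℕ) (e : ι → ℂ → ℂ) : Prop where
  eq_zero : ∀ i z, C.cover z ∉ L.U i → e i z = 0
  norm_eq_one : ∀ i z, C.cover z ∈ L.U i → ‖e i z‖ = 1
  trans : ∀ i j z, C.cover z ∈ L.U i → C.cover z ∈ L.U j →
    e i z = L.g i j (C.cover z) * e j z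
  contDiffOn : ∀ i, ContDiffOn ℝ ∞ (e i) (C.cover ⁻¹' L.U i)
  hasFDerivAt : ∀ i z, C.cover z ∈ L.U i → HasFDerivAt (e i)
    ((Complex.I * e i z) • Complex.ofRealCLM.comp
      ((k : ℝ) • C.potential z - L.A i (C.cover z))) z

/-- Near every point, the connection differs from the standard potential by an exact form. -/
theorem IsDegreeOnePolarization.exists_local_primitive {L : C.HermitianLineBundle ι}
    (hL : L.IsDegreeOnePolarization) (z : ℂ) :
    ∃ (i : ι) (r : ℝ) (φ : ℂ → ℝ), 0 < r ∧
      Metric.ball z r ⊆ C.cover ⁻¹' L.U i ∧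
      (∀ w ∈ Metric.ball z r, HasFDerivAt φ (C.potential w - L.A i (C.cover w)) w) ∧
      ContDiffOn ℝ ∞ φ (Metric.ball z r) := by
  obtain ⟨i, hi⟩ := L.exists_mem_U (C.cover z)
  obtain ⟨r, hr, hball⟩ := Metric.isOpen_iff.mp (L.isOpen_preimage_U i) z hi
  have hA : ContDiffOn ℝ ∞ (fun w => C.potential w - L.A i (C.cover w)) (Metric.ball z r) :=
    C.potential.contDiff.contDiffOn.sub ((L.contDiffOn_A i).mono hball)
  -- Poincaré lemma on a ball: the potential is alternating, so its exterior derivative is twice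
  -- itself, -2πω, which equals that of `L.A i`.
  obtain ⟨φ, hφ⟩ := (convex_ball z r).exists_forall_hasFDerivAt_of_fderiv_symmetric
    Metric.isOpen_ball (hA.differentiableOn (by simp)) (by
      intro a ha x y
      have hd : DifferentiableAt ℝ (fun w => L.A i (C.cover w)) a :=
        ((L.contDiffOn_A i).differentiableOn (by simp)).differentiableAt
          ((L.isOpen_preimage_U i).mem_nhds (hball ha))
      have h1 : fderiv ℝ (fun w => C.potential w - L.A i (C.cover w)) a =
          C.potential - fderiv ℝ (fun w => L.A i (C.cover w)) a :=
        (C.potential.hasFDerivAt.sub hd.hasFDerivAt).fderiv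
      have h2 := hL i a (hball ha) x y
      have h3 := C.potential_swap x y
      rw [h1]
      simp only [sub_apply]
      rw [h3, potential_apply]
      linarith)
  refine ⟨i, r, φ, hr, hball, hφ, ?_⟩
  rw [contDiffOn_infty_iff_fderiv_of_isOpen Metric.isOpen_ball]
  exact ⟨fun w hw => (hφ w hw).differentiableAt.differentiableWithinAt,
    hA.congr fun w hw => (hφ w hw).fderiv⟩

theorem hasFDerivAt_exp_I_mul {φ : ℂ → ℝ} {φ' : ℂ →L[ℝ] ℝ} {z : ℂ} (h : HasFDerivAt φ φ' z) :
    HasFDerivAt (fun w => (Circle.exp (φ w) : ℂ))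
      ((Complex.I * Circle.exp (φ z)) • Complex.ofRealCLM.comp φ') z := by
  have h1 := ((Complex.ofRealCLM.hasFDerivAt.comp z h).mul_const Complex.I).cexp
  simp only [Circle.coe_exp]
  convert! h1 using 1
  ext v
  simp [mul_comm, mul_left_comm, mul_assoc]

/-- Each ball carries the frame e^{iφ}. The ratios of these frames are locally constant phases,
hence a coboundary on ℂ, and correcting by it makes the local frames agree. -/
theorem IsDegreeOnePolarization.exists_isFrame {L : C.HermitianLineBundle ι}
    (hL : L.IsDegreeOnePolarization) : ∃ e, L.IsFrame 1 e := by
  classical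
  choose p r φ hr hball hφ hφs using hL.exists_local_primitive
  let W : ℂ → Set ℂ := fun a => Metric.ball a (r a)
  have hW : ∀ a, IsOpen (W a) := fun a => Metric.isOpen_ball
  have hmem : ∀ z, z ∈ W z := fun z => Metric.mem_ball_self (hr z)
  have hWU : ∀ {a z}, z ∈ W a → C.cover z ∈ L.U (p a) := fun hz => hball _ hz
  -- Ratio of the frame on the ball b to the frame on the ball a.
  let c : ℂ → ℂ → ℂ → Circle := fun a b z =>
    Circle.exp (-φ a z) * L.g (p a) (p b) (C.cover z) * Circle.exp (φ b z)
  have hc : ∀ a b d z, z ∈ W a → z ∈ W b → z ∈ W d → c a b z * c b d z = c a d z := by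
    intro a b d z ha hb hd
    simp only [c, Circle.exp_neg]
    rw [← L.cocycle (p a) (p b) (p d) _ (hWU ha) (hWU hb) (hWU hd)]
    group
  have hloc : ∀ a b z, z ∈ W a → z ∈ W b → ∀ᶠ w in nhds z, c a b w = c a b z := by
    intro a b z ha hb
    have hopen : IsOpen (W a ∩ W b) := (hW a).inter (hW b)
    have hconv : Convex ℝ (W a ∩ W b) := (convex_ball _ _).inter (convex_ball _ _)
    -- The difference of the two primitives has differential A_b - A_a up to sign, and this cancels
    -- the gauge term of g.
    have hd : ∀ w ∈ W a ∩ W b, HasFDerivAt (fun w => (c a b w : ℂ)) (0 : ℂ →L[ℝ] ℂ) w := by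
      rintro w ⟨hwa, hwb⟩
      have h := ((hasFDerivAt_exp_I_mul (hφ a w hwa).neg).mul
        (L.hasFDerivAt_g (hWU hwa) (hWU hwb))).mul (hasFDerivAt_exp_I_mul (hφ b w hwb))
      simp only [c, Circle.coe_mul]
      refine h.congr_fderiv ?_
      ext v
      simp
      ring
    filter_upwards [hopen.mem_nhds ⟨ha, hb⟩] with w hw
    refine Circle.ext (hopen.is_const_of_fderiv_eq_zero hconv.isPreconnected
      (fun w hw => (hd w hw).differentiableAt.differentiableWithinAt)
      (fun w hw => (hd w hw).fderiv) hw ⟨ha, hb⟩)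
  obtain ⟨h, hh, hhloc⟩ := exists_locallyConstant_coboundary W hW id hmem c hc hloc
  -- At z the ball centred at z is used; by `hform` any other ball containing z gives the same
  -- value.
  let e : ι → ℂ → ℂ := fun i z => if C.cover z ∈ L.U i then
    ((L.g i (p z) (C.cover z) * Circle.exp (φ z z) * h z z : Circle) : ℂ) else 0
  have hform : ∀ i a z, C.cover z ∈ L.U i → z ∈ W a →
      e i z = ((L.g i (p a) (C.cover z) * Circle.exp (φ a z) * h a z : Circle) : ℂ) := by
    intro i a z hi ha
    simp only [e, if_pos hi]
    rw [hh z a z (hmem z) ha, ← L.cocycle i (p z) (p a) _ hi (hWU (hmem z)) (hWU ha)]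
    simp only [c, Circle.exp_neg, mul_assoc, mul_inv_cancel_left]
  have hlocal : ∀ i z, C.cover z ∈ L.U i → e i =ᶠ[nhds z]
      fun w => (L.g i (p z) (C.cover w) : ℂ) * Circle.exp (φ z w) * h z z := by
    intro i z hi
    filter_upwards [(L.isOpen_preimage_U i).mem_nhds hi, (hW z).mem_nhds (hmem z),
      hhloc z z (hmem z)] with w hw1 hw2 hw3
    rw [hform i z w hw1 hw2, hw3]
    simp
  refine ⟨e, fun i z hz => if_neg hz, fun i z hz => ?_, fun i j z hi hj => ?_, fun i => ?_,
    fun i z hz => ?_⟩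
  · simp only [e, if_pos hz, Circle.norm_coe]
  · rw [hform i z z hi (hmem z), hform j z z hj (hmem z), ← Circle.coe_mul,
      ← L.cocycle i j (p z) _ hi hj (hWU (hmem z))]
    simp only [mul_assoc]
  · intro z hz
    refine ContDiffAt.contDiffWithinAt ?_
    refine ContDiffAt.congr_of_eventuallyEq ?_ (hlocal i z hz)
    have h1 : ContDiffAt ℝ ∞ (fun w => (L.g i (p z) (C.cover w) : ℂ)) z :=
      (L.contDiffOn_g i (p z)).contDiffAt (((L.isOpen_preimage_U i).inter
        (L.isOpen_preimage_U (p z))).mem_nhds ⟨hz, hWU (hmem z)⟩)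
    have h2 : ContDiffAt ℝ ∞ (φ z) z := (hφs z).contDiffAt ((hW z).mem_nhds (hmem z))
    have h3 : ContDiffAt ℝ ∞ (fun w => (Circle.exp (φ z w) : ℂ)) z := by
      simp only [Circle.coe_exp]
      exact ((Complex.ofRealCLM.contDiff.contDiffAt.comp z h2).mul contDiffAt_const).cexp
    exact (h1.mul h3).mul contDiffAt_const
  · refine HasFDerivAt.congr_of_eventuallyEq ?_ (hlocal i z hz)
    have := ((L.hasFDerivAt_g hz (hWU (hmem z))).mul
      (hasFDerivAt_exp_I_mul (hφ z z (hmem z)))).mul_const (h z z : ℂ)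
    refine this.congr_fderiv ?_
    rw [hform i z z hz (hmem z)]
    ext v
    simp
    ring

namespace IsFrame

variable {L} {k : ℕ} {e : ι → ℂ → ℂ}

theorem ne_zero (he : L.IsFrame k e) {i : ι} {z : ℂ} (hz : C.cover z ∈ L.U i) : e i z ≠ 0 := by
  rw [← norm_ne_zero_iff, he.norm_eq_one i z hz]
  exact one_ne_zero

/-- The exponent is k + 1 because the components are extended by zero, and a zeroth power would be 1
outside `L.U i`. -/
theorem pow (he : L.IsFrame 1 e) (k : ℕ) : (L.pow (k + 1)).IsFrame (k + 1) (e ^ (k + 1)) where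
  eq_zero i z hz := by
    change e i z ^ (k + 1) = 0
    rw [he.eq_zero i z hz]
    simp
  norm_eq_one i z hz := by
    change ‖e i z ^ (k + 1)‖ = 1
    rw [norm_pow, he.norm_eq_one i z hz, one_pow]
  trans i j z hi hj := by
    change e i z ^ (k + 1) = ((L.g i j (C.cover z) ^ (k + 1) : Circle) : ℂ) * e j z ^ (k + 1)
    rw [he.trans i j z hi hj, mul_pow, Circle.coe_pow]
  contDiffOn i := (he.contDiffOn i).pow (k + 1)
  hasFDerivAt i z hz := by
    have := (he.hasFDerivAt i z hz).pow (k + 1)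
    refine this.congr_fderiv ?_
    change _ = (Complex.I * e i z ^ (k + 1)) • Complex.ofRealCLM.comp
      (((k + 1 : ℕ) : ℝ) • C.potential z - ((k + 1 : ℕ) : ℝ) • L.A i (C.cover z))
    ext v
    simp
    ring

end IsFrame

end HermitianLineBundle
end MarkedEllipticCurve
end

/-! ### Parallel transport and flat sections along the fibres -/

noncomputable section
namespace MarkedEllipticCurve

variable (C : MarkedEllipticCurve)

/-- The sign of the determinant of the period basis. -/
def detSign : ℤ := if 0 < C.det then 1 else -1

theorem detSign_eq_or : C.detSign = 1 ∨ C.detSign = -1 := by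
  unfold detSign
  split_ifs <;> simp

theorem detSign_mul_self : C.detSign * C.detSign = 1 := by
  rcases C.detSign_eq_or with h | h <;> simp [h]

theorem detSign_mul_abs : (C.detSign : ℝ) * |C.det| = C.det := by
  unfold detSign
  split_ifs with h
  · simp [abs_of_pos h]
  · simp [abs_of_nonpos (not_lt.mp h)]

theorem det_eq_detSign_mul : (C.detSign : ℝ) * C.det = |C.det| := by
  have h : (C.detSign : ℝ) * C.detSign = 1 := by exact_mod_cast C.detSign_mul_self
  rw [← C.detSign_mul_abs, ← mul_assoc, h, one_mul, C.detSign_mul_abs]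

theorem ωp_mem_lattice : C.ωp ∈ C.lattice := AddSubgroup.subset_closure (by simp)

theorem ωm_mem_lattice : C.ωm ∈ C.lattice := AddSubgroup.subset_closure (by simp)

theorem ωp_ne_zero : C.ωp ≠ 0 := by
  intro h
  exact C.det_ne_zero (by simp [det, h])

theorem realPolarization_cover (z : ℂ) :
    C.realPolarization (C.cover z) = Circle.exp (2 * Real.pi * C.coordMinus z) := rfl

theorem coordMinus_add (z w : ℂ) : C.coordMinus (z + w) = C.coordMinus z + C.coordMinus w := by
  simp only [coordMinus, mul_add, Complex.add_im, add_div]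

theorem coordMinus_real_mul (t : ℝ) (w : ℂ) : C.coordMinus (t * w) = t * C.coordMinus w := by
  simp only [coordMinus, mul_left_comm _ (t : ℂ), Complex.im_ofReal_mul, mul_div_assoc]

theorem coordMinus_ωp : C.coordMinus C.ωp = 0 := by simp [coordMinus, mul_comm]

theorem coordMinus_ωm : C.coordMinus C.ωm = 1 := div_self C.det_ne_zero

/-- The kernel of the second coordinate is the line spanned by the first period. -/
theorem exists_eq_mul_ωp {z : ℂ} (hz : C.coordMinus z = 0) : ∃ t : ℝ, z = t * C.ωp := by
  have h0 : (star C.ωp * z).im = 0 := by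
    simpa [coordMinus, C.det_ne_zero] using hz
  have hs : star C.ωp ≠ 0 := star_ne_zero.mpr C.ωp_ne_zero
  have hre : ((star C.ωp * z).re : ℂ) = star C.ωp * z := Complex.ext rfl (by rw [h0, Complex.ofReal_im])
  refine ⟨(star C.ωp * z).re / Complex.normSq C.ωp, ?_⟩
  have hn : (Complex.normSq C.ωp : ℂ) = star C.ωp * C.ωp := by
    rw [Complex.star_def, Complex.normSq_eq_conj_mul_self]
  push_cast
  rw [hre, hn]
  field_simp [C.ωp_ne_zero]

/-- The polarization fibre through `[z₀]` is the image of the line `z₀ + ℝ ω₊`. -/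
theorem exists_eq_add_of_realPolarization_eq {z z₀ : ℂ}
    (h : C.realPolarization (C.cover z) = C.realPolarization (C.cover z₀)) :
    ∃ (t : ℝ) (l : ℂ), l ∈ C.lattice ∧ z = z₀ + t * C.ωp + l := by
  rw [realPolarization_cover, realPolarization_cover, Circle.exp_eq_exp] at h
  obtain ⟨m, hm⟩ := h
  have hm' : C.coordMinus z = C.coordMinus z₀ + m := by
    have h2 : (2 * Real.pi) ≠ 0 := by positivity
    apply mul_left_cancel₀ h2
    linear_combination hm
  obtain ⟨t, ht⟩ := C.exists_eq_mul_ωp (z := z - z₀ - (m : ℝ) * C.ωm) (by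
    have h1 := C.coordMinus_add (z - z₀ - (m : ℝ) * C.ωm) (z₀ + (m : ℝ) * C.ωm)
    rw [C.coordMinus_add z₀, coordMinus_real_mul, coordMinus_ωm] at h1
    have h3 : z - z₀ - (m : ℝ) * C.ωm + (z₀ + (m : ℝ) * C.ωm) = z := by ring
    rw [h3, hm'] at h1
    linarith)
  refine ⟨t, m • C.ωm, AddSubgroup.zsmul_mem _ C.ωm_mem_lattice m, ?_⟩
  rw [← ht, zsmul_eq_mul]
  push_cast
  ring

theorem exists_realPolarization_cover_eq (b : Circle) :
    ∃ z, C.realPolarization (C.cover z) = b := by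
  refine ⟨(Complex.arg b / (2 * Real.pi) : ℝ) * C.ωm, ?_⟩
  rw [realPolarization_cover, coordMinus_real_mul, coordMinus_ωm, mul_one,
    mul_div_cancel₀ _ (by positivity), Circle.exp_arg]

theorem mem_lattice_iff {z : ℂ} : z ∈ C.lattice ↔ ∃ m n : ℤ, m * C.ωp + n * C.ωm = z := by
  simp [lattice, AddSubgroup.mem_closure_pair]

/-- A real multiple of the first period is a period only if the multiple is integral. -/
theorem exists_int_of_mul_ωp_mem {t : ℝ} (h : t * C.ωp ∈ C.lattice) : ∃ n : ℤ, t = n := by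
  obtain ⟨m, n, hmn⟩ := C.mem_lattice_iff.mp h
  have h1 := congrArg C.coordMinus hmn
  have hm : ((m : ℂ) * C.ωp) = ((m : ℝ) : ℂ) * C.ωp := by push_cast; rfl
  have hn : ((n : ℂ) * C.ωm) = ((n : ℝ) : ℂ) * C.ωm := by push_cast; rfl
  rw [hm, hn, coordMinus_add, coordMinus_real_mul, coordMinus_real_mul, coordMinus_real_mul,
    coordMinus_ωp, coordMinus_ωm] at h1
  have hn0 : (n : ℝ) = 0 := by linarith
  rw [hm, hn, hn0] at hmn
  refine ⟨m, ?_⟩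
  have := mul_right_cancel₀ C.ωp_ne_zero (by simpa using hmn : ((m : ℝ) : ℂ) * C.ωp = t * C.ωp)
  exact_mod_cast this.symm

/-- This is how the holonomy sees the base point. The sign appears because the Kähler form is
normalized by |det| and the coordinate by det. -/
theorem potential_ωp (z : ℂ) :
    C.potential C.ωp z = -(Real.pi * (C.detSign * C.coordMinus z)) := by
  rw [potential_apply, kahlerForm, coordMinus, ← C.det_eq_detSign_mul]
  have h := C.det_ne_zero
  have h' : (C.detSign : ℝ) * C.detSign = 1 := by exact_mod_cast C.detSign_mul_self
  have hs : (C.detSign : ℝ) ≠ 0 := left_ne_zero_of_mul_eq_one h'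
  field_simp
  rw [sq, h', mul_one]

namespace HermitianLineBundle

variable {C} {ι : Type*} {L : C.HermitianLineBundle ι} {k : ℕ} {e : ι → ℂ → ℂ}

variable (L) in
/-- A chosen local frame around each point. -/
def frameIndex (x : C.Points) : ι := (L.exists_mem_U x).choose

variable (L) in
theorem mem_U_frameIndex (x : C.Points) : x ∈ L.U (L.frameIndex x) := (L.exists_mem_U x).choose_spec

variable (L) in
/-- The function `s / e` on the universal cover, for a section `s` and a frame `e`. -/
def frameQuot (e s : ι → ℂ → ℂ) (z : ℂ) : ℂ :=
  s (L.frameIndex (C.cover z)) z / e (L.frameIndex (C.cover z)) z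

namespace IsFrame

theorem frameQuot_eq (he : L.IsFrame k e) {s : ι → ℂ → ℂ}
    (hs : ∀ i j z, C.cover z ∈ L.U i → C.cover z ∈ L.U j → s i z = L.g i j (C.cover z) * s j z)
    {i : ι} {z : ℂ} (hz : C.cover z ∈ L.U i) : L.frameQuot e s z = s i z / e i z := by
  have hj := L.mem_U_frameIndex (C.cover z)
  rw [frameQuot, div_eq_div_iff (he.ne_zero hj) (he.ne_zero hz), hs i _ z hz hj,
    he.trans i _ z hz hj]
  ring

theorem eq_frameQuot_mul (he : L.IsFrame k e) {s : ι → ℂ → ℂ}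
    (hs : ∀ i j z, C.cover z ∈ L.U i → C.cover z ∈ L.U j → s i z = L.g i j (C.cover z) * s j z)
    {i : ι} {z : ℂ} (hz : C.cover z ∈ L.U i) : s i z = L.frameQuot e s z * e i z := by
  rw [he.frameQuot_eq hs hz, div_mul_cancel₀ _ (he.ne_zero hz)]

theorem frameQuot_eventuallyEq (he : L.IsFrame k e) {s : ι → ℂ → ℂ}
    (hs : ∀ i j z, C.cover z ∈ L.U i → C.cover z ∈ L.U j → s i z = L.g i j (C.cover z) * s j z)
    {i : ι} {z : ℂ} (hz : C.cover z ∈ L.U i) :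
    L.frameQuot e s =ᶠ[nhds z] fun w => s i w / e i w := by
  filter_upwards [(L.isOpen_preimage_U i).mem_nhds hz] with w hw
  exact he.frameQuot_eq hs hw

theorem hasFDerivAt_frameQuot (he : L.IsFrame k e) {s : ι → ℂ → ℂ}
    (hs : ∀ i j z, C.cover z ∈ L.U i → C.cover z ∈ L.U j → s i z = L.g i j (C.cover z) * s j z)
    {i : ι} {z : ℂ} (hz : C.cover z ∈ L.U i) {s' : ℂ →L[ℝ] ℂ} (h : HasFDerivAt (s i) s' z) :
    HasFDerivAt (L.frameQuot e s) ((e i z)⁻¹ • s' - (Complex.I * L.frameQuot e s z) •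
      Complex.ofRealCLM.comp ((k : ℝ) • C.potential z - L.A i (C.cover z))) z := by
  refine HasFDerivAt.congr_of_eventuallyEq ?_ (he.frameQuot_eventuallyEq hs hz)
  have hne := he.ne_zero hz
  have h2 := h.mul ((hasDerivAt_inv hne).comp_hasFDerivAt z (he.hasFDerivAt i z hz))
  simp only [div_eq_mul_inv]
  refine h2.congr_fderiv ?_
  rw [he.frameQuot_eq hs hz]
  ext v
  simp
  field_simp
  ring

/-- The factor of automorphy of the frame. -/
theorem exists_multiplier (he : L.IsFrame k e) {l : ℂ} (hl : l ∈ C.lattice) :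
    ∃ c : Circle, ∀ i z, e i (z + l) = c * Circle.exp (k * C.potential l z) * e i z := by
  let s : ι → ℂ → ℂ := fun i z => e i (z + l)
  have hs : ∀ i j z, C.cover z ∈ L.U i → C.cover z ∈ L.U j →
      s i z = L.g i j (C.cover z) * s j z := by
    intro i j z hi hj
    rw [← C.cover_add hl z] at hi hj ⊢
    exact he.trans i j _ hi hj
  -- The ratio e(z + l)/e(z) with its expected phase removed. It is constant because the potentials
  -- at z + l and z differ by the potential at l.
  let r : ℂ → ℂ := fun z => L.frameQuot e s z * Circle.exp (-(k * C.potential l z))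
  have hr : ∀ z, HasFDerivAt r (0 : ℂ →L[ℝ] ℂ) z := by
    intro z
    have hz := L.mem_U_frameIndex (C.cover z)
    set i := L.frameIndex (C.cover z)
    have hzl : C.cover (z + l) ∈ L.U i := by rwa [C.cover_add hl]
    have h1 : HasFDerivAt (s i) _ z := (he.hasFDerivAt i (z + l) hzl).comp z
      ((hasFDerivAt_id z).add_const l)
    have h2 := he.hasFDerivAt_frameQuot hs hz h1
    have h3 : HasFDerivAt (fun z => -((k : ℝ) * C.potential l z)) (-((k : ℝ) • C.potential l)) z :=
      ((C.potential l).hasFDerivAt.const_mul (k : ℝ)).neg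
    refine (h2.mul (hasFDerivAt_exp_I_mul h3)).congr_fderiv ?_
    rw [he.frameQuot_eq hs hz, C.cover_add hl]
    have hne := he.ne_zero hz
    ext v
    simp [s]
    field_simp
    ring
  have hconst : ∀ z, r z = r 0 := fun z =>
    is_const_of_fderiv_eq_zero (fun z => (hr z).differentiableAt) (fun z => (hr z).fderiv) z 0
  have hnorm : ‖r 0‖ = 1 := by
    have h0 := L.mem_U_frameIndex (C.cover 0)
    simp only [r, norm_mul, Circle.norm_coe, mul_one, he.frameQuot_eq hs h0, norm_div]
    rw [he.norm_eq_one _ _ h0, he.norm_eq_one _ _ (by rwa [C.cover_add hl]), div_one]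
  obtain ⟨c, hc⟩ : ∃ c : Circle, (c : ℂ) = r 0 := ⟨⟨r 0, mem_sphere_zero_iff_norm.mpr hnorm⟩, rfl⟩
  refine ⟨c, fun i z => ?_⟩
  by_cases hz : C.cover z ∈ L.U i
  · have h1 : e i (z + l) = L.frameQuot e s z * e i z := he.eq_frameQuot_mul hs hz
    rw [h1, hc, ← hconst z]
    simp only [r, Circle.exp_neg, Circle.coe_inv]
    rw [mul_assoc (L.frameQuot e s z), inv_mul_cancel₀ (Circle.coe_ne_zero _), mul_one]
  · rw [he.eq_zero i z hz, he.eq_zero i _ (by rwa [C.cover_add hl]), mul_zero]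

/-- The covariant constant section along a fibre with value `e` at `t = 0`. -/
theorem isParallelAlongFibre (he : L.IsFrame k e) (z : ℂ) :
    L.IsParallelAlongFibre z fun i t =>
      Circle.exp (k * C.potential C.ωp z * t) * e i (z + t * C.ωp) := by
  refine ⟨fun i t ht => ?_, fun i j t hi hj => ?_, fun i t ht => ?_⟩
  · simp only [he.eq_zero i _ ht, mul_zero]
  · simp only [he.trans i j _ hi hj]
    ring
  · have h1 : HasDerivAt (fun t : ℝ => e i (z + t * C.ωp)) _ t :=
      (he.hasFDerivAt i _ ht).comp_hasDerivAt t
        (((Complex.ofRealCLM.hasDerivAt (x := t)).mul_const C.ωp).const_add z)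
    have h2 : HasDerivAt (fun t : ℝ => (Circle.exp (k * C.potential C.ωp z * t) : ℂ))
        (Complex.I * (k * C.potential C.ωp z) * Circle.exp (k * C.potential C.ωp z * t)) t := by
      simp only [Circle.coe_exp]
      have := ((Complex.ofRealCLM.hasDerivAt.scomp t
        ((hasDerivAt_id t).const_mul ((k : ℝ) * C.potential C.ωp z))).mul_const Complex.I).cexp
      refine this.congr_deriv ?_
      simp
      ring
    refine (h2.mul h1).congr_deriv ?_
    -- The potential is alternating, so the connection form is constant along the line and a phase
    -- linear in t compensates it.
    have h3 : C.potential (z + t * C.ωp) C.ωp = - C.potential C.ωp z := by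
      rw [C.potential_swap C.ωp, map_add, ← Complex.real_smul, map_smul, C.potential_self]
      simp
    simp only [smul_apply, ContinuousLinearMap.comp_apply, sub_apply, h3, Complex.ofRealCLM_apply,
      Complex.ofReal_one, one_mul, smul_eq_mul, Complex.ofReal_sub, Complex.ofReal_mul,
      Complex.ofReal_neg, Complex.ofReal_natCast]
    ring

/-- In the quotient by the explicit nowhere vanishing solution the transition functions cancel, and
its derivative is zero because both satisfy the same first-order linear equation. -/
theorem eq_of_isParallelAlongFibre (he : L.IsFrame k e) {z : ℂ} {v : ι → ℝ → ℂ}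
    (hv : L.IsParallelAlongFibre z v) : ∃ a : ℂ, ∀ i t,
      v i t = a * (Circle.exp (k * C.potential C.ωp z * t) * e i (z + t * C.ωp)) := by
  obtain ⟨hp1, hp2, hp3⟩ := he.isParallelAlongFibre z
  obtain ⟨hv1, hv2, hv3⟩ := hv
  set p : ι → ℝ → ℂ := fun i t => Circle.exp (k * C.potential C.ωp z * t) * e i (z + t * C.ωp)
  have hne : ∀ {i : ι} {t : ℝ}, C.cover (z + t * C.ωp) ∈ L.U i → p i t ≠ 0 := fun ht =>
    mul_ne_zero (Circle.coe_ne_zero _) (he.ne_zero ht)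
  let j : ℝ → ι := fun t => L.frameIndex (C.cover (z + t * C.ωp))
  have hj : ∀ t : ℝ, C.cover (z + t * C.ωp) ∈ L.U (j t) := fun t => L.mem_U_frameIndex _
  let u : ℝ → ℂ := fun t => v (j t) t / p (j t) t
  have hu : ∀ {i : ι} {t : ℝ}, C.cover (z + t * C.ωp) ∈ L.U i → u t = v i t / p i t := by
    intro i t hi
    rw [div_eq_div_iff (hne (hj t)) (hne hi), hv2 i _ t hi (hj t), hp2 i _ t hi (hj t)]
    ring
  have hd : ∀ t, HasDerivAt u 0 t := by
    intro t
    have hopen : IsOpen {w : ℝ | C.cover (z + w * C.ωp) ∈ L.U (j t)} :=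
      (L.isOpen_preimage_U (j t)).preimage (by fun_prop : Continuous fun w : ℝ => z + w * C.ωp)
    have hev : u =ᶠ[nhds t] fun w => v (j t) w / p (j t) w := by
      filter_upwards [hopen.mem_nhds (hj t)] with w hw
      exact hu hw
    refine HasDerivAt.congr_of_eventuallyEq ?_ hev
    refine ((hv3 _ t (hj t)).fun_div (hp3 _ t (hj t)) (hne (hj t))).congr_deriv ?_
    rw [div_eq_zero_iff]
    left
    ring
  have hconst : ∀ t, u t = u 0 := fun t =>
    is_const_of_deriv_eq_zero (fun t => (hd t).differentiableAt) (fun t => (hd t).deriv) t 0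
  refine ⟨u 0, fun i t => ?_⟩
  by_cases ht : C.cover (z + t * C.ωp) ∈ L.U i
  · rw [← hconst t, hu ht, div_mul_cancel₀ _ (hne ht)]
  · change _ = _ * p i t
    rw [hv1 i t ht, hp1 i t ht, mul_zero]

/-- The covariant constant sections along a fibre are multiplied by `c e^{2 i k α}` when one goes
once around. -/
theorem parallel_add_int (he : L.IsFrame k e) {c : Circle}
    (hc : ∀ i z, e i (z + C.ωp) = c * Circle.exp (k * C.potential C.ωp z) * e i z)
    {z : ℂ} {v : ι → ℝ → ℂ} (hv : L.IsParallelAlongFibre z v) (n : ℤ) (i : ι) (t : ℝ) :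
    v i (t + n) = ((c * Circle.exp (2 * (k * C.potential C.ωp z))) ^ n : Circle) * v i t := by
  obtain ⟨a, ha⟩ := he.eq_of_isParallelAlongFibre hv
  have h1 : ∀ t, v i (t + 1) = (c * Circle.exp (2 * (k * C.potential C.ωp z)) : Circle) * v i t := by
    intro t
    have h3 : C.potential C.ωp (z + t * C.ωp) = C.potential C.ωp z := by
      rw [map_add, ← Complex.real_smul, map_smul, C.potential_self]
      simp
    have h4 : z + ((t + 1 : ℝ) : ℂ) * C.ωp = z + t * C.ωp + C.ωp := by push_cast; ring
    -- The factor 2 in the phase: one half is the linear phase of the parallel section at t + 1, the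
    -- other the automorphy factor of the frame.
    rw [ha, ha, h4, hc, h3, two_mul, mul_add, mul_one, Circle.exp_add, Circle.exp_add]
    push_cast
    ring
  generalize c * Circle.exp (2 * (k * C.potential C.ωp z)) = q at h1 ⊢
  induction n using Int.induction_on with
  | zero => simp
  | succ m ih =>
    have h5 : t + ((m + 1 : ℤ) : ℝ) = t + ((m : ℤ) : ℝ) + 1 := by push_cast; ring
    rw [h5, h1, ih, zpow_add_one, Circle.coe_mul]
    ring
  | pred m ih =>
    have := h1 (t + ((-(m : ℤ) - 1 : ℤ) : ℝ))
    have h5 : t + ((-(m : ℤ) - 1 : ℤ) : ℝ) + 1 = t + ((-(m : ℤ) : ℤ) : ℝ) := by push_cast; ring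
    rw [h5, ih] at this
    rw [zpow_sub_one, mul_comm _ (_ : Circle)⁻¹, Circle.coe_mul, mul_assoc, this, ← mul_assoc,
      ← Circle.coe_mul, inv_mul_cancel, Circle.coe_one, one_mul]

/-- A character of ℤ is determined by its value at 1, and `potential_ωp` rewrites the phase of one
full turn as a power of b. The explicit parallel section, nonzero at t = 0 in a suitable frame,
detects this value. -/
theorem isHolonomyCharacter_iff (he : L.IsFrame k e) {c : Circle}
    (hc : ∀ i z, e i (z + C.ωp) = c * Circle.exp (k * C.potential C.ωp z) * e i z)
    (b : Circle) (χ : AddChar ℤ Circle) :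
    L.IsHolonomyCharacter b χ ↔ χ 1 = c * (b ^ C.detSign)⁻¹ ^ k := by
  have hq : ∀ z, C.realPolarization (C.cover z) = b →
      c * Circle.exp (2 * (k * C.potential C.ωp z)) = c * (b ^ C.detSign)⁻¹ ^ k := by
    intro z hz
    rw [← hz, C.realPolarization_cover, ← Circle.exp_zsmul, ← Circle.exp_neg, ← Circle.exp_nsmul,
      C.potential_ωp]
    congr 2
    simp
    ring
  constructor
  · intro h
    obtain ⟨z, hz⟩ := C.exists_realPolarization_cover_eq b
    have hp := he.isParallelAlongFibre z
    have hi := L.mem_U_frameIndex (C.cover z)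
    set i := L.frameIndex (C.cover z)
    have h1 := h z hz _ hp 1 i 0
    have h2 := he.parallel_add_int hc hp 1 i 0
    rw [h1, zpow_one, hq z hz] at h2
    refine Circle.ext (mul_right_cancel₀ ?_ h2)
    simpa using he.ne_zero hi
  · intro h z hz v hv n i t
    rw [he.parallel_add_int hc hv, hq z hz, ← h, ← AddChar.map_zsmul_eq_zpow]
    simp

/-- The covariant constant sections over a Bohr–Sommerfeld fibre form a line. -/
theorem finrank_flatSections (he : L.IsFrame k e) {b : Circle} (hb : L.IsBohrSommerfeld b) :
    Module.finrank ℂ (L.flatSections b) = 1 := by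
  classical
  obtain ⟨z₀, hz₀⟩ := C.exists_realPolarization_cover_eq b
  have hp := he.isParallelAlongFibre z₀
  have hloop := hb z₀ hz₀ _ hp
  set p : ι → ℝ → ℂ := fun i t => Circle.exp (k * C.potential C.ωp z₀ * t) * e i (z₀ + t * C.ωp)
  have hline : ∀ t : ℝ, C.realPolarization (C.cover (z₀ + t * C.ωp)) = b := fun t => by
    rw [← hz₀, realPolarization_cover, realPolarization_cover, coordMinus_add,
      coordMinus_real_mul, coordMinus_ωp, mul_zero, add_zero]
  have hparam : ∀ x, C.realPolarization x = b → ∃ t : ℝ, x = C.cover (z₀ + t * C.ωp) := by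
    intro x hx
    obtain ⟨z, rfl⟩ := QuotientAddGroup.mk_surjective x
    obtain ⟨t, l, hl, rfl⟩ := C.exists_eq_add_of_realPolarization_eq (hx.trans hz₀.symm)
    exact ⟨t, C.cover_add hl _⟩
  choose! τ hτ using hparam
  -- The parallel section descends: two parameters of the same point differ by an integer, and the
  -- holonomy is trivial.
  let f : ι → C.Points → ℂ := fun i x => if C.realPolarization x = b then p i (τ x) else 0
  have hf : ∀ i (t : ℝ), f i (C.cover (z₀ + t * C.ωp)) = p i t := by
    intro i t
    simp only [f, if_pos (hline t)]
    have h1 := hτ _ (hline t)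
    set t' := τ (C.cover (z₀ + t * C.ωp))
    have h2 : ((t' - t : ℝ) : ℂ) * C.ωp ∈ C.lattice := by
      have := QuotientAddGroup.eq.mp h1
      convert! this using 1
      push_cast
      ring
    obtain ⟨n, hn⟩ := C.exists_int_of_mul_ωp_mem h2
    have h3 : p i (t + n) = ((1 : AddChar ℤ Circle) n : ℂ) * p i t := hloop n i t
    rw [show t' = t + n by linarith, h3]
    simp
  have hfmem : f ∈ L.flatSections b := by
    refine ⟨fun i x hx => ?_, fun i j x hi hj => ?_, fun i z hz hzb => ?_⟩
    · by_cases hxb : C.realPolarization x = b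
      · have h1 : x ∉ L.U i := fun h => hx ⟨h, hxb⟩
        simp only [f, if_pos hxb]
        exact hp.1 i _ (by rwa [← hτ x hxb])
      · simp only [f, if_neg hxb]
    · by_cases hxb : C.realPolarization x = b
      · have h1 := hτ x hxb
        rw [h1] at hi hj
        rw [h1, hf, hf]
        exact hp.2.1 i j _ hi hj
      · simp only [f, if_neg hxb, mul_zero]
    · obtain ⟨t₀, l, hl, rfl⟩ := C.exists_eq_add_of_realPolarization_eq (hzb.trans hz₀.symm)
      rw [C.cover_add hl] at hz ⊢
      have h1 : ∀ t : ℝ, f i (C.cover (z₀ + t₀ * C.ωp + l + t * C.ωp)) = p i (t₀ + t) := by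
        intro t
        rw [add_right_comm, C.cover_add hl, ← hf]
        congr 2
        push_cast
        ring
      simp_rw [h1, hf]
      have h2 := hp.2.2 i t₀ hz
      rw [← add_zero t₀] at h2
      simpa using h2.comp_const_add t₀ 0
  refine finrank_eq_one_iff'.mpr ⟨⟨f, hfmem⟩, fun h0 => ?_, fun s => ?_⟩
  · have hi := L.mem_U_frameIndex (C.cover z₀)
    set i := L.frameIndex (C.cover z₀)
    have h1 : f = 0 := congrArg Subtype.val h0
    have h2 := hf i 0
    rw [h1] at h2
    simp only [p, Complex.ofReal_zero, zero_mul, add_zero, mul_zero, Circle.exp_zero,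
      Circle.coe_one, one_mul] at h2
    exact he.ne_zero hi h2.symm
  · obtain ⟨s, hs1, hs2, hs3⟩ := s
    -- Conversely, a flat section pulls back to a parallel one on the line, hence to a multiple of
    -- p.
    have hpar : L.IsParallelAlongFibre z₀ fun i t => s i (C.cover (z₀ + t * C.ωp)) := by
      refine ⟨fun i t ht => hs1 i _ fun h => ht h.1, fun i j t hi hj => hs2 i j _ hi hj,
        fun i t ht => ?_⟩
      have h1 := hs3 i _ ht (hline t)
      have h2 : ∀ w : ℝ, z₀ + t * C.ωp + w * C.ωp = z₀ + ((t + w : ℝ) : ℂ) * C.ωp := fun w => by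
        push_cast; ring
      simp_rw [h2] at h1
      have h3 := HasDerivAt.comp_const_add (-t) t
        (f := fun w : ℝ => s i (C.cover (z₀ + ((t + w : ℝ) : ℂ) * C.ωp)))
        (by rw [neg_add_cancel]; exact h1)
      simpa using h3
    obtain ⟨a, ha⟩ := he.eq_of_isParallelAlongFibre hpar
    refine ⟨a, Subtype.ext ?_⟩
    funext i x
    change a * f i x = s i x
    by_cases hxb : C.realPolarization x = b
    · rw [hτ x hxb, hf]
      exact (ha i _).symm
    · rw [hs1 i x fun h => hxb h.2]
      simp only [f, if_neg hxb, mul_zero]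

end IsFrame

end HermitianLineBundle
end MarkedEllipticCurve
end

/-! ### Holomorphic sections as theta functions -/

noncomputable section
namespace MarkedEllipticCurve

variable (C : MarkedEllipticCurve)

/-- The second period, with its sign changed if necessary to make the period basis positively
oriented. -/
def orientedPeriod : ℂ := C.detSign * C.ωm

/-- The period ratio in the upper half plane. -/
def modulus : ℂ := C.orientedPeriod / C.ωp

theorem orientedPeriod_mem_lattice : C.orientedPeriod ∈ C.lattice := by
  rw [orientedPeriod, ← zsmul_eq_mul]
  exact AddSubgroup.zsmul_mem _ C.ωm_mem_lattice _

theorem ωp_mul_modulus : C.ωp * C.modulus = C.orientedPeriod :=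
  mul_div_cancel₀ _ C.ωp_ne_zero

theorem normSq_ωp_ne_zero : Complex.normSq C.ωp ≠ 0 := by
  simpa using C.ωp_ne_zero

theorem im_modulus : C.modulus.im = |C.det| / Complex.normSq C.ωp := by
  rw [eq_div_iff C.normSq_ωp_ne_zero, ← C.det_eq_detSign_mul, det]
  have h : (Complex.normSq C.ωp : ℂ) * C.modulus = (C.detSign : ℝ) * (star C.ωp * C.ωm) := by
    rw [Complex.normSq_eq_conj_mul_self, Complex.star_def, mul_assoc, C.ωp_mul_modulus,
      orientedPeriod]
    push_cast
    ring
  have := congrArg Complex.im h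
  rw [Complex.im_ofReal_mul, Complex.im_ofReal_mul] at this
  rw [mul_comm, this]

theorem im_modulus_pos : 0 < C.modulus.im := by
  rw [C.im_modulus]
  have := C.det_ne_zero
  have := C.ωp_ne_zero
  have := Complex.normSq_pos.mpr this
  positivity

theorem lattice_le_of_mem {S : AddSubgroup ℂ} (h1 : C.ωp ∈ S)
    (h2 : C.orientedPeriod ∈ S) : C.lattice ≤ S := by
  rw [lattice, AddSubgroup.closure_le]
  rintro z (rfl | rfl)
  · exact h1
  · have : C.ωm = C.detSign • C.orientedPeriod := by
      have h : (C.detSign : ℂ) * C.detSign = 1 := by exact_mod_cast C.detSign_mul_self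
      rw [zsmul_eq_mul, orientedPeriod, ← mul_assoc, h, one_mul]
    rw [SetLike.mem_coe, this]
    exact S.zsmul_mem h2 _

/-- The exponent of the Gaussian weight. -/
def weight (k : ℕ) : ℝ := k * Real.pi * Complex.normSq C.ωp / (2 * |C.det|)

/-- The normalization that fixes the level: four times this quantity is the 2πk in the exponent of
the theta multiplier. -/
theorem weight_mul_im_modulus (k : ℕ) : C.weight k * C.modulus.im = k * Real.pi / 2 := by
  rw [im_modulus, weight]
  have h1 := C.normSq_ωp_ne_zero
  have h2 := abs_ne_zero.mpr C.det_ne_zero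
  field_simp

theorem natCast_mul_potential (k : ℕ) (v w : ℂ) :
    k * C.potential (C.ωp * v) (C.ωp * w) = -(2 * C.weight k * (star v * w).im) := by
  rw [potential_apply, kahlerForm, weight]
  have h : star (C.ωp * v) * (C.ωp * w) = (Complex.normSq C.ωp : ℝ) * (star v * w) := by
    rw [Complex.normSq_eq_conj_mul_self, star_mul, Complex.star_def]
    ring
  rw [h, Complex.im_ofReal_mul]
  have h2 := abs_ne_zero.mpr C.det_ne_zero
  field_simp

/-- The change of gauge from the unitary frame, in the coordinate `w = z / ω₊`, to a holomorphic
frame in which sections become theta functions. -/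
def thetaGauge (k : ℕ) (γ : ℝ) (w : ℂ) : ℂ :=
  Complex.exp (C.weight k * (w * star w - w * w) + Complex.I * γ * w)

theorem thetaGauge_ne_zero (k : ℕ) (γ : ℝ) (w : ℂ) : C.thetaGauge k γ w ≠ 0 :=
  Complex.exp_ne_zero _

theorem contDiff_thetaGauge (k : ℕ) (γ : ℝ) : ContDiff ℝ ∞ (C.thetaGauge k γ) := by
  have h : ContDiff ℝ ∞ (fun w : ℂ => star w) := Complex.conjCLE.contDiff
  unfold thetaGauge
  refine ContDiff.cexp ?_
  fun_prop

/-- The term w w̄ of the gauge cancels the dependence on w̄, and -w² reduces the dependence on w to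
a multiple of Im v. For v = 1 only the constant e^{iγ} remains, ready to cancel the phase of the
frame along ω₊. -/
theorem thetaGauge_add (k : ℕ) (γ : ℝ) (w v : ℂ) :
    Circle.exp (-(k * C.potential (C.ωp * v) (C.ωp * w))) * C.thetaGauge k γ (w + v) =
      Complex.exp (C.weight k * (v * star v - v * v) + Complex.I * γ * v
        - 4 * Complex.I * C.weight k * v.im * w) * C.thetaGauge k γ w := by
  rw [C.natCast_mul_potential, thetaGauge, thetaGauge, Circle.coe_exp, ← Complex.exp_add,
    ← Complex.exp_add]
  congr 1
  have h1 : ((star v * w).im : ℂ) = (star v * w - v * star w) / (2 * Complex.I) := by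
    rw [Complex.im_eq_sub_conj]; simp
  have h2 : (v.im : ℂ) = (v - star v) / (2 * Complex.I) := by
    rw [Complex.im_eq_sub_conj, Complex.star_def]
  push_cast
  rw [h1, h2, star_add]
  field_simp [Complex.I_ne_zero]
  ring

/-- The change of gauge intertwines the `∂̄`-operator of the connection with the standard one. -/
theorem differentiableAt_mul_thetaGauge_iff {k : ℕ} (γ : ℝ) {F : ℂ → ℂ} {F' : ℂ →L[ℝ] ℂ} {w : ℂ}
    (hF : HasFDerivAt F F' (C.ωp * w)) :
    DifferentiableAt ℂ (fun w => F (C.ωp * w) * C.thetaGauge k γ w) w ↔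
      F' 1 + Complex.I * F' Complex.I +
        k * Real.pi / |C.det| * (C.ωp * w) * F (C.ωp * w) = 0 := by
  have hstar : HasFDerivAt (fun w : ℂ => star w) (Complex.conjCLE : ℂ →L[ℝ] ℂ) w :=
    Complex.conjCLE.hasFDerivAt
  have hid : HasFDerivAt (fun w : ℂ => w) (ContinuousLinearMap.id ℝ ℂ) w := hasFDerivAt_id w
  have hG : HasFDerivAt (C.thetaGauge k γ) (C.thetaGauge k γ w •
      ((C.weight k : ℂ) • (w • (Complex.conjCLE : ℂ →L[ℝ] ℂ) +
        star w • ContinuousLinearMap.id ℝ ℂ - (w • ContinuousLinearMap.id ℝ ℂ +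
          w • ContinuousLinearMap.id ℝ ℂ)) +
        (Complex.I * γ) • ContinuousLinearMap.id ℝ ℂ)) w :=
    ((((hid.mul hstar).sub (hid.mul hid)).const_mul (C.weight k : ℂ)).add
      (hid.const_mul (Complex.I * γ))).cexp
  have hm : HasFDerivAt (fun w : ℂ => C.ωp * w) _ w := hid.const_mul C.ωp
  have hH : HasFDerivAt (fun w => F (C.ωp * w) * C.thetaGauge k γ w) _ w :=
    (hF.comp w hm).mul hG
  have hF'u : ∀ u : ℂ, F' u = u.re * F' 1 + u.im * F' Complex.I := by
    intro u
    conv_lhs => rw [show u = u.re • (1 : ℂ) + u.im • Complex.I by simp]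
    rw [map_add, map_smul, map_smul, Complex.real_smul, Complex.real_smul]
  -- The Cauchy–Riemann defect of the product is a nonzero factor times the ∂̄-expression. The
  -- conjugate of ω₊ in it comes from the substitution z = ω₊ w.
  have key : fderiv ℝ (fun w => F (C.ωp * w) * C.thetaGauge k γ w) w Complex.I -
      Complex.I * fderiv ℝ (fun w => F (C.ωp * w) * C.thetaGauge k γ w) w 1 =
      -(Complex.I * C.thetaGauge k γ w * star C.ωp) * (F' 1 + Complex.I * F' Complex.I +
        k * Real.pi / |C.det| * (C.ωp * w) * F (C.ωp * w)) := by
    have hw : (2 * C.weight k : ℂ) = k * Real.pi / |C.det| * (C.ωp * star C.ωp) := by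
      rw [weight, Complex.star_def, Complex.mul_conj]
      push_cast
      ring
    have hp : star C.ωp = C.ωp.re - C.ωp.im * Complex.I := by
      apply Complex.ext <;> simp
    rw [hH.fderiv]
    simp only [add_apply, smul_apply, ContinuousLinearMap.comp_apply, sub_apply,
      ContinuousLinearMap.id_apply, smul_eq_mul, Function.comp_apply, mul_one,
      ContinuousLinearEquiv.coe_coe, Complex.conjCLE_apply, map_one, Complex.conj_I]
    rw [hF'u C.ωp, hF'u (C.ωp * Complex.I)]
    simp only [Complex.mul_I_re, Complex.mul_I_im, Complex.ofReal_neg]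
    linear_combination (-(Complex.I * C.thetaGauge k γ w * w * F (C.ωp * w))) * hw +
      (Complex.I * C.thetaGauge k γ w * (F' 1 + Complex.I * F' Complex.I)) * hp +
      C.thetaGauge k γ w * (C.ωp.re * F' Complex.I - C.ωp.im * F' 1 -
        Complex.I * C.ωp.im * F' Complex.I) * Complex.I_mul_I
  rw [differentiableAt_complex_iff_differentiableAt_real, smul_eq_mul, ← sub_eq_zero, key]
  have hne : -(Complex.I * C.thetaGauge k γ w * star C.ωp) ≠ 0 :=
    neg_ne_zero.mpr (mul_ne_zero (mul_ne_zero Complex.I_ne_zero (C.thetaGauge_ne_zero k γ w))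
      (star_ne_zero.mpr C.ωp_ne_zero))
  rw [mul_eq_zero, or_iff_right hne]
  exact and_iff_right hH.differentiableAt

namespace HermitianLineBundle

variable {C} {ι : Type*} {L : C.HermitianLineBundle ι} {k : ℕ} {e : ι → ℂ → ℂ}

namespace IsFrame

theorem covDeriv_eq (he : L.IsFrame k e) {i : ι} {f : C.Points → ℂ} {F : ℂ → ℂ}
    {F' : ℂ →L[ℝ] ℂ} {z : ℂ} (hz : C.cover z ∈ L.U i) (hF : HasFDerivAt F F' z)
    (hf : ∀ w, C.cover w ∈ L.U i → f (C.cover w) = F w * e i w) (v : ℂ) :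
    L.covDeriv i f z v = (F' v + Complex.I * (k * C.potential z v) * F z) * e i z := by
  have hev : (fun w => f (C.cover w)) =ᶠ[nhds z] fun w => F w * e i w := by
    filter_upwards [(L.isOpen_preimage_U i).mem_nhds hz] with w hw
    exact hf w hw
  rw [covDeriv, hev.fderiv_eq, (hF.fun_mul (he.hasFDerivAt i z hz)).fderiv, hf z hz]
  simp
  ring

/-- The potential in the directions 1 and i is π Im z/|det| and -π Re z/|det|, and these combine
into the single term kπz/|det|. -/
theorem dbar_eq (he : L.IsFrame k e) {i : ι} {f : C.Points → ℂ} {F : ℂ → ℂ}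
    {F' : ℂ →L[ℝ] ℂ} {z : ℂ} (hz : C.cover z ∈ L.U i) (hF : HasFDerivAt F F' z)
    (hf : ∀ w, C.cover w ∈ L.U i → f (C.cover w) = F w * e i w) :
    L.covDeriv i f z 1 + Complex.I * L.covDeriv i f z Complex.I =
      (F' 1 + Complex.I * F' Complex.I + k * Real.pi / |C.det| * z * F z) * e i z := by
  rw [he.covDeriv_eq hz hF hf, he.covDeriv_eq hz hF hf, potential_apply, potential_apply]
  simp only [kahlerForm]
  have h1 : ((star z * 1).im : ℝ) = -z.im := by simp
  have h2 : ((star z * Complex.I).im : ℝ) = z.re := by simp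
  rw [h1, h2]
  push_cast
  linear_combination -(k * Real.pi * z.re / (|C.det| : ℝ) * F z * e i z) * Complex.I_mul_I +
    k * Real.pi / (|C.det| : ℝ) * F z * e i z * Complex.re_add_im z

variable (L) in
/-- The theta function of a section: its component in the holomorphic frame on the universal
cover, in the coordinate `z / ω₊`. -/
def toTheta (k : ℕ) (e : ι → ℂ → ℂ) (γ : ℝ) : L.holomorphicSections →ₗ[ℂ] (ℂ → ℂ) where
  toFun f w := L.frameQuot e (fun i z => f.1 i (C.cover z)) (C.ωp * w) * C.thetaGauge k γ w
  map_add' f f' := by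
    ext w
    simp only [frameQuot, Submodule.coe_add, Pi.add_apply]
    ring
  map_smul' a f := by
    ext w
    simp only [frameQuot, Submodule.coe_smul, Pi.smul_apply, smul_eq_mul, RingHom.id_apply]
    ring

theorem toTheta_injective (he : L.IsFrame k e) (γ : ℝ) :
    Function.Injective (toTheta L k e γ) := by
  rw [injective_iff_map_eq_zero]
  rintro ⟨f, hf1, hf2, hf3, hf4⟩ h
  refine Subtype.ext (funext fun i => funext fun x => ?_)
  obtain ⟨z, rfl⟩ := QuotientAddGroup.mk_surjective x
  change f i (C.cover z) = 0
  by_cases hz : C.cover z ∈ L.U i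
  · have h1 := congrFun h (z / C.ωp)
    simp only [toTheta, LinearMap.coe_mk, AddHom.coe_mk, mul_div_cancel₀ _ C.ωp_ne_zero,
      Pi.zero_apply, mul_eq_zero, C.thetaGauge_ne_zero, or_false] at h1
    have := he.eq_frameQuot_mul (s := fun i z => f i (C.cover z))
      (fun i j z hi hj => hf2 i j _ hi hj) hz
    rw [h1, zero_mul] at this
    exact this
  · exact hf1 i _ hz

/-- The multiplier of the theta functions of the sections of a line bundle. -/
def _root_.MarkedEllipticCurve.thetaMultiplier (C : MarkedEllipticCurve) (k : ℕ) (γ : ℝ)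
    (c : Circle) : ℂ :=
  (c : ℂ)⁻¹ * Complex.exp (C.weight k * (C.modulus * star C.modulus - C.modulus * C.modulus) +
    Complex.I * γ * C.modulus)

theorem _root_.MarkedEllipticCurve.inv_mul_exp_eq_thetaMultiplier (C : MarkedEllipticCurve)
    (k : ℕ) (γ : ℝ) (c : Circle) (w : ℂ) :
    (c : ℂ)⁻¹ * Complex.exp (C.weight k * (C.modulus * star C.modulus - C.modulus * C.modulus) +
      Complex.I * γ * C.modulus - 4 * Complex.I * C.weight k * C.modulus.im * w) =
    C.thetaMultiplier k γ c * Complex.exp (-(2 * Real.pi * Complex.I * k * w)) := by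
  have h : (C.weight k : ℂ) * C.modulus.im = k * Real.pi / 2 := by
    exact_mod_cast congrArg Complex.ofReal (C.weight_mul_im_modulus k)
  rw [thetaMultiplier, mul_assoc (c : ℂ)⁻¹, ← Complex.exp_add]
  congr 2
  linear_combination -4 * Complex.I * w * h

theorem _root_.MarkedEllipticCurve.inv_mul_exp_eq_one (C : MarkedEllipticCurve)
    (k : ℕ) (γ : ℝ) (w : ℂ) :
    (Circle.exp γ : ℂ)⁻¹ * Complex.exp (C.weight k * (1 * star 1 - 1 * 1) +
      Complex.I * γ * 1 - 4 * Complex.I * C.weight k * (1 : ℂ).im * w) = 1 := by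
  rw [Circle.coe_exp, ← Complex.exp_neg, ← Complex.exp_add, ← Complex.exp_zero]
  congr 1
  simp
  ring

/-- The section itself is invariant under periods, so the quotient acquires the inverse of the
automorphy factor of the frame. -/
theorem frameQuot_add (he : L.IsFrame k e) {l : ℂ} (hl : l ∈ C.lattice) {c : Circle}
    (hc : ∀ i z, e i (z + l) = c * Circle.exp (k * C.potential l z) * e i z)
    {f : ι → C.Points → ℂ} (hf : f ∈ L.holomorphicSections) (z : ℂ) :
    L.frameQuot e (fun i z => f i (C.cover z)) (z + l) = (c : ℂ)⁻¹ *
      Circle.exp (-(k * C.potential l z)) * L.frameQuot e (fun i z => f i (C.cover z)) z := by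
  have hs : ∀ i j z, C.cover z ∈ L.U i → C.cover z ∈ L.U j →
      f i (C.cover z) = L.g i j (C.cover z) * f j (C.cover z) := fun i j z => hf.2.1 i j _
  have hz := L.mem_U_frameIndex (C.cover z)
  rw [he.frameQuot_eq hs hz, he.frameQuot_eq hs (by rwa [C.cover_add hl]), C.cover_add hl, hc,
    Circle.exp_neg, Circle.coe_inv]
  have h1 := he.ne_zero hz
  have h2 := Circle.coe_ne_zero c
  have h3 := Circle.coe_ne_zero (Circle.exp (k * C.potential l z))
  field_simp

/-- The gauge exchanges holomorphy of H with the ∂̄-equation, and the two functional equations with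
invariance of the section under the generators ω₊ and ±ω₋ of the lattice. -/
theorem range_toTheta (he : L.IsFrame k e) {γ : ℝ} {c : Circle}
    (hp : ∀ i z, e i (z + C.ωp) = Circle.exp γ * Circle.exp (k * C.potential C.ωp z) * e i z)
    (hm : ∀ i z, e i (z + C.orientedPeriod) =
      c * Circle.exp (k * C.potential C.orientedPeriod z) * e i z) :
    LinearMap.range (toTheta L k e γ) =
      thetaSpace k C.modulus (C.thetaMultiplier k γ c) := by
  apply le_antisymm
  · rintro _ ⟨⟨f, hf⟩, rfl⟩
    have hs : ∀ i j z, C.cover z ∈ L.U i → C.cover z ∈ L.U j →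
        f i (C.cover z) = L.g i j (C.cover z) * f j (C.cover z) := fun i j z => hf.2.1 i j _
    have hq : ∀ (v : ℂ) (c : Circle), C.ωp * v ∈ C.lattice →
        (∀ i z, e i (z + C.ωp * v) = c * Circle.exp (k * C.potential (C.ωp * v) z) * e i z) →
        ∀ w, toTheta L k e γ ⟨f, hf⟩ (w + v) =
          (c : ℂ)⁻¹ * Complex.exp (C.weight k * (v * star v - v * v) + Complex.I * γ * v
            - 4 * Complex.I * C.weight k * v.im * w) * toTheta L k e γ ⟨f, hf⟩ w := by
      intro v c hl hc w
      simp only [toTheta, LinearMap.coe_mk, AddHom.coe_mk, mul_add]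
      rw [he.frameQuot_add hl hc hf]
      linear_combination (c : ℂ)⁻¹ * L.frameQuot e (fun i z => f i (C.cover z)) (C.ωp * w) *
        C.thetaGauge_add k γ w v
    refine ⟨fun w => ?_, fun w => ?_, fun w => ?_⟩
    · have hz := L.mem_U_frameIndex (C.cover (C.ωp * w))
      set i := L.frameIndex (C.cover (C.ωp * w))
      have hd : DifferentiableAt ℝ (fun z => f i (C.cover z)) (C.ωp * w) :=
        ((hf.2.2.1 i).differentiableOn (by simp)).differentiableAt
          ((L.isOpen_preimage_U i).mem_nhds hz)
      have hF := he.hasFDerivAt_frameQuot (s := fun i z => f i (C.cover z)) hs hz hd.hasFDerivAt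
      refine (C.differentiableAt_mul_thetaGauge_iff γ hF).mpr ?_
      have h1 := hf.2.2.2 i _ hz
      rw [he.dbar_eq hz hF fun w hw =>
        he.eq_frameQuot_mul (s := fun i z => f i (C.cover z)) hs hw] at h1
      exact (mul_eq_zero.mp h1).resolve_right (he.ne_zero hz)
    · rw [hq 1 (Circle.exp γ) (by rw [mul_one]; exact C.ωp_mem_lattice) (by rwa [mul_one]),
        C.inv_mul_exp_eq_one, one_mul]
    · rw [hq C.modulus c (by rw [C.ωp_mul_modulus]; exact C.orientedPeriod_mem_lattice)
        (by rwa [C.ωp_mul_modulus]), C.inv_mul_exp_eq_thetaMultiplier]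
  · rintro H ⟨hd, hH1, hHτ⟩
    let F : ℂ → ℂ := fun z => H (z / C.ωp) * (C.thetaGauge k γ (z / C.ωp))⁻¹
    have hFs : ContDiff ℝ ∞ F := by
      have h1 : ContDiff ℝ ∞ H := (hd.contDiff (n := ∞)).restrict_scalars ℝ
      have h2 : ContDiff ℝ ∞ fun z : ℂ => z / C.ωp := by fun_prop
      exact (h1.comp h2).mul (((C.contDiff_thetaGauge k γ).comp h2).inv
        fun z => C.thetaGauge_ne_zero k γ _)
    have hFH : ∀ w, F (C.ωp * w) * C.thetaGauge k γ w = H w := fun w => by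
      simp only [F, mul_div_cancel_left₀ _ C.ωp_ne_zero]
      exact inv_mul_cancel_right₀ (C.thetaGauge_ne_zero k γ w) _
    clear_value F
    have hq : ∀ (v : ℂ) (c : Circle),
        (∀ i z, e i (z + C.ωp * v) = c * Circle.exp (k * C.potential (C.ωp * v) z) * e i z) →
        (∀ w, H (w + v) = (c : ℂ)⁻¹ * Complex.exp (C.weight k * (v * star v - v * v) +
          Complex.I * γ * v - 4 * Complex.I * C.weight k * v.im * w) * H w) →
        ∀ i z, F (z + C.ωp * v) * e i (z + C.ωp * v) = F z * e i z := by
      intro v c hc hH i z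
      obtain ⟨w, rfl⟩ : ∃ w, z = C.ωp * w := ⟨z / C.ωp, (mul_div_cancel₀ _ C.ωp_ne_zero).symm⟩
      have h1 := hFH (w + v)
      have h2 := C.thetaGauge_add k γ w v
      have h3 := Circle.coe_ne_zero c
      rw [hH, ← hFH w, mul_add] at h1
      rw [Circle.exp_neg, Circle.coe_inv] at h2
      rw [hc]
      have h4 := Circle.coe_ne_zero (Circle.exp (k * C.potential (C.ωp * v) (C.ωp * w)))
      set E := Complex.exp (C.weight k * (v * star v - v * v) +
          Complex.I * γ * v - 4 * Complex.I * C.weight k * v.im * w)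
      have hE : E ≠ 0 := Complex.exp_ne_zero _
      have hG := C.thetaGauge_ne_zero k γ w
      have h5 : C.thetaGauge k γ (w + v) =
          Circle.exp (k * C.potential (C.ωp * v) (C.ωp * w)) * (E * C.thetaGauge k γ w) := by
        rw [← h2, mul_inv_cancel_left₀ h4]
      rw [h5] at h1
      have h6 : F (C.ωp * w + C.ωp * v) *
          (c * Circle.exp (k * C.potential (C.ωp * v) (C.ωp * w))) = F (C.ωp * w) := by
        field_simp at h1
        rw [← mul_add]
        linear_combination h1
      rw [← mul_assoc, h6]
    -- The translations preserving F e form a subgroup, so invariance need only be checked on two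
    -- generators.
    let S : AddSubgroup ℂ :=
      { carrier := {l | ∀ i z, F (z + l) * e i (z + l) = F z * e i z}
        zero_mem' := by simp
        add_mem' := fun {a b} ha hb i z => by rw [← add_assoc, hb, ha]
        neg_mem' := fun {a} ha i z => by rw [← ha i (z + -a), neg_add_cancel_right] }
    have hS : C.lattice ≤ S := by
      refine C.lattice_le_of_mem ?_ ?_
      · have := hq 1 (Circle.exp γ) (by rwa [mul_one]) fun w => by
          rw [hH1, C.inv_mul_exp_eq_one, one_mul]
        rwa [mul_one] at this
      · have := hq C.modulus c (by rwa [C.ωp_mul_modulus]) fun w => by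
          rw [hHτ, C.inv_mul_exp_eq_thetaMultiplier]
        rwa [C.ωp_mul_modulus] at this
    -- Any representative of x may be used, by invariance under the lattice.
    let f : ι → C.Points → ℂ := fun i x => F x.out * e i x.out
    have hf : ∀ i z, f i (C.cover z) = F z * e i z := by
      intro i z
      have h1 : C.cover (C.cover z).out = C.cover z := QuotientAddGroup.out_eq' _
      have h2 := hS (QuotientAddGroup.eq.mp h1) i (C.cover z).out
      rw [add_neg_cancel_left] at h2
      exact h2.symm
    have hfmem : f ∈ L.holomorphicSections := by
      refine ⟨fun i x hx => ?_, fun i j x hi hj => ?_, fun i => ?_, fun i z hz => ?_⟩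
      · obtain ⟨z, rfl⟩ := QuotientAddGroup.mk_surjective x
        change f i (C.cover z) = 0
        rw [hf, he.eq_zero i z hx, mul_zero]
      · obtain ⟨z, rfl⟩ := QuotientAddGroup.mk_surjective x
        change f i (C.cover z) = L.g i j (C.cover z) * f j (C.cover z)
        rw [hf, hf, he.trans i j z hi hj]
        ring
      · simp_rw [hf]
        exact hFs.contDiffOn.mul (he.contDiffOn i)
      · have hF := (hFs.differentiable (by simp) z).hasFDerivAt
        rw [he.dbar_eq hz hF fun w _ => hf i w]
        obtain ⟨w, rfl⟩ : ∃ w, z = C.ωp * w := ⟨z / C.ωp, (mul_div_cancel₀ _ C.ωp_ne_zero).symm⟩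
        rw [(C.differentiableAt_mul_thetaGauge_iff γ hF).mp, zero_mul]
        simp_rw [hFH]
        exact hd w
    refine ⟨⟨f, hfmem⟩, funext fun w => ?_⟩
    rw [← hFH w]
    simp only [toTheta, LinearMap.coe_mk, AddHom.coe_mk]
    congr 1
    have hz := L.mem_U_frameIndex (C.cover (C.ωp * w))
    rw [frameQuot, hf, mul_div_cancel_right₀ _ (he.ne_zero hz)]

theorem finrank_holomorphicSections (he : L.IsFrame k e) (hk : 1 ≤ k) :
    Module.finrank ℂ L.holomorphicSections = k := by
  obtain ⟨c₀, hp⟩ := he.exists_multiplier C.ωp_mem_lattice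
  obtain ⟨c, hm⟩ := he.exists_multiplier C.orientedPeriod_mem_lattice
  -- Taking γ = arg c₀ in the gauge makes H exactly 1-periodic.
  rw [← Circle.exp_arg c₀] at hp
  rw [(LinearEquiv.ofInjective _ (he.toTheta_injective (Complex.arg c₀))).finrank_eq,
    he.range_toTheta hp hm]
  exact finrank_thetaSpace hk C.im_modulus_pos
    (mul_ne_zero (inv_ne_zero (Circle.coe_ne_zero c)) (Complex.exp_ne_zero _))

end IsFrame

end HermitianLineBundle
end MarkedEllipticCurve
end

/-! ### Roots of unity and the comparison of the two quantizations -/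

noncomputable section

theorem Circle.ncard_setOf_pow_eq_one {k : ℕ} (hk : 1 ≤ k) :
    {ζ : Circle | ζ ^ k = 1}.ncard = k := by
  have : NeZero k := ⟨by omega⟩
  have h1 : {ζ : Circle | ζ ^ k = 1} = (fun u : Circleˣ => (u : Circle)) '' rootsOfUnity k Circle := by
    ext ζ
    constructor
    · intro h
      exact ⟨_root_.toUnits ζ, (mem_rootsOfUnity _ _).mpr (Units.ext (by simpa using h)), rfl⟩
    · rintro ⟨u, hu, rfl⟩
      simpa using congrArg Units.val ((mem_rootsOfUnity _ _).mp hu)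
  rw [h1, Set.ncard_image_of_injective _ Units.val_injective, ← Nat.card_coe_set_eq]
  change Nat.card (rootsOfUnity k Circle) = k
  rw [Nat.card_congr (rootsOfUnityCircleEquiv k).toEquiv, Complex.card_rootsOfUnity]

theorem AddChar.ext_int {G : Type*} [CommGroup G] {χ ψ : AddChar ℤ G} (h : χ 1 = ψ 1) : χ = ψ := by
  ext n
  have h1 : ∀ χ : AddChar ℤ G, χ n = χ 1 ^ n := fun χ => by
    rw [← AddChar.map_zsmul_eq_zpow]; simp
  rw [h1 χ, h1 ψ, h]

theorem AddChar.exists_int_eq {G : Type*} [CommGroup G] (q : G) : ∃ χ : AddChar ℤ G, χ 1 = q :=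
  ⟨{ toFun := fun n => q ^ n
     map_zero_eq_one' := zpow_zero q
     map_add_eq_mul' := fun m n => zpow_add q m n }, zpow_one q⟩

namespace MarkedEllipticCurve

/-- As the sign is ±1, being a k-th root of unity is unaffected by passing to the inverse, which
allows solving for b. -/
theorem mul_zpow_detSign_inv_pow_eq_one_iff (C : MarkedEllipticCurve) (c b : Circle) (k : ℕ) :
    (c * (b ^ C.detSign)⁻¹) ^ k = 1 ↔ ∃ ζ : Circle, ζ ^ k = 1 ∧ c ^ C.detSign * ζ = b := by
  have h : (c * (b ^ C.detSign)⁻¹) ^ k = 1 ↔ ((c ^ C.detSign)⁻¹ * b) ^ k = 1 := by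
    rcases C.detSign_eq_or with h | h
    · rw [h, zpow_one, zpow_one, ← inv_eq_one, ← inv_pow, mul_inv_rev, inv_inv, mul_comm]
    · rw [h, zpow_neg_one, zpow_neg_one, inv_inv, inv_inv]
  rw [h]
  constructor
  · exact fun h => ⟨_, h, mul_inv_cancel_left _ _⟩
  · rintro ⟨ζ, hζ, rfl⟩
    rwa [inv_mul_cancel_left]

namespace HermitianLineBundle

variable {C : MarkedEllipticCurve} {ι : Type*} {L : C.HermitianLineBundle ι} {e : ι → ℂ → ℂ}

theorem IsFrame.isHolonomyCharacter_pow_iff (he : L.IsFrame 1 e) {c : Circle}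
    (hc : ∀ i z, e i (z + C.ωp) = c * Circle.exp ((1 : ℕ) * C.potential C.ωp z) * e i z)
    (k : ℕ) (b : Circle) (χ : AddChar ℤ Circle) :
    (L.pow (k + 1)).IsHolonomyCharacter b χ ↔ χ 1 = (c * (b ^ C.detSign)⁻¹) ^ (k + 1) := by
  rw [mul_pow]
  refine (he.pow k).isHolonomyCharacter_iff (c := c ^ (k + 1)) (fun i z => ?_) b χ
  change e i (z + C.ωp) ^ (k + 1) = _ * e i z ^ (k + 1)
  rw [hc, mul_pow, mul_pow, ← Circle.coe_pow, ← Circle.coe_pow, ← Circle.exp_nsmul]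
  congr 4
  simp

end HermitianLineBundle

end MarkedEllipticCurve

end

theorem mainTheorem3 (C : MarkedEllipticCurve) {ι : Type*} (L : C.HermitianLineBundle ι)
    (hL : L.IsDegreeOnePolarization) :
    ∃ b₀ : Circle, {b | L.IsBohrSommerfeld b} = {b₀} ∧
      ∀ k : ℕ, 1 ≤ k →
        -- complex quantization, real quantization, and their comparison
        Module.finrank ℂ (L.pow k).holomorphicSections = k ∧
        {b | (L.pow k).IsBohrSommerfeld b}.ncard = k ∧
        (∀ b, (L.pow k).IsBohrSommerfeld b → Module.finrank ℂ ((L.pow k).flatSections b) = 1) ∧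
        Module.finrank ℂ (L.pow k).holomorphicSections =
          Module.finrank ℂ (L.pow k).RealWaveFunctions ∧
        -- `s_{L^k}` is a section of `Pic(C / S¹₋) → S¹₋`
        (∀ b, ∃! χ : AddChar ℤ Circle, (b, χ) ∈ (L.pow k).picSection) ∧
        -- the Bohr–Sommerfeld fibres are the `k`-th roots of unity, when `b₀` is taken as the
        -- origin of the base, and they are the points of `s₀ ∩ s_{L^k}`
        {b | (L.pow k).IsBohrSommerfeld b} = (fun ζ : Circle => b₀ * ζ) '' {ζ | ζ ^ k = 1} ∧
        MarkedEllipticCurve.picZeroSection ∩ (L.pow k).picSection =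
          (fun ζ : Circle => (b₀ * ζ, (1 : AddChar ℤ Circle))) '' {ζ | ζ ^ k = 1} := by
  obtain ⟨e, he⟩ := hL.exists_isFrame
  obtain ⟨c, hc⟩ := he.exists_multiplier C.ωp_mem_lattice
  -- The solution b of c b^{-σ} = 1, where σ = ±1 is `C.detSign`.
  refine ⟨c ^ C.detSign, ?_, ?_⟩
  · ext b
    have h1 : L.IsBohrSommerfeld b ↔ _ := he.isHolonomyCharacter_iff hc b 1
    have h2 := C.mul_zpow_detSign_inv_pow_eq_one_iff c b 1
    rw [Set.mem_ofPred_eq, h1, Set.mem_singleton_iff, AddChar.one_apply, pow_one]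
    simp only [pow_one, exists_eq_left, mul_one] at h2
    rw [eq_comm, h2, eq_comm]
  · intro k hk
    obtain ⟨k, rfl⟩ : ∃ m, k = m + 1 := ⟨k - 1, by omega⟩
    have hhol := he.isHolonomyCharacter_pow_iff hc k
    have hbs : ∀ b, (L.pow (k + 1)).IsBohrSommerfeld b ↔
        ∃ ζ : Circle, ζ ^ (k + 1) = 1 ∧ c ^ C.detSign * ζ = b := fun b => by
      rw [← C.mul_zpow_detSign_inv_pow_eq_one_iff]
      exact (hhol b 1).trans eq_comm
    have hset : {b | (L.pow (k + 1)).IsBohrSommerfeld b} =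
        (fun ζ : Circle => c ^ C.detSign * ζ) '' {ζ | ζ ^ (k + 1) = 1} := Set.ext hbs
    have hcard : {b | (L.pow (k + 1)).IsBohrSommerfeld b}.ncard = k + 1 := by
      rw [hset, Set.ncard_image_of_injective _ (mul_right_injective _),
        Circle.ncard_setOf_pow_eq_one hk]
    have hflat : ∀ b, (L.pow (k + 1)).IsBohrSommerfeld b →
        Module.finrank ℂ ((L.pow (k + 1)).flatSections b) = 1 :=
      fun b hb => (he.pow k).finrank_flatSections hb
    have hsec := (he.pow k).finrank_holomorphicSections hk
    refine ⟨hsec, hcard, hflat, ?_, fun b => ?_, hset, ?_⟩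
    -- The index set has k elements and each summand is a line, so the rank of the direct sum is a
    -- sum of k ones.
    · have hfin : {b | (L.pow (k + 1)).IsBohrSommerfeld b}.Finite :=
        Set.finite_of_ncard_ne_zero (by rw [hcard]; omega)
      have : Fintype {b // (L.pow (k + 1)).IsBohrSommerfeld b} := hfin.fintype
      have hfree : ∀ b : {b // (L.pow (k + 1)).IsBohrSommerfeld b},
          Module.Finite ℂ ((L.pow (k + 1)).flatSections b) := fun b =>
        Module.finite_of_finrank_eq_succ (hflat b b.2)
      rw [hsec, Module.finrank_directSum]
      simp_rw [fun b : {b // (L.pow (k + 1)).IsBohrSommerfeld b} => hflat b b.2]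
      rw [Finset.sum_const, smul_eq_mul, mul_one, Finset.card_univ, ← Nat.card_eq_fintype_card]
      exact hcard.symm
    · obtain ⟨χ, hχ⟩ := AddChar.exists_int_eq ((c * (b ^ C.detSign)⁻¹) ^ (k + 1))
      exact ⟨χ, (hhol b χ).mpr hχ, fun ψ hψ => AddChar.ext_int (((hhol b ψ).mp hψ).trans hχ.symm)⟩
    · ext ⟨b, χ⟩
      constructor
      · rintro ⟨rfl : χ = 1, h⟩
        obtain ⟨ζ, hζ, rfl⟩ := (hbs b).mp h
        exact ⟨ζ, hζ, rfl⟩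
      · rintro ⟨ζ, hζ, h⟩
        obtain ⟨rfl, rfl⟩ := Prod.mk.inj h
        exact ⟨rfl, (hbs _).mpr ⟨ζ, hζ, rfl⟩⟩
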